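/- Let $\mathbb{T}^1=\mathbb{R}/2\pi\mathbb{Z}$ and let $\mathbb{S}^3$ be the group of unit quaternions with its normalized Haar measure. For each $\ell\in\frac12\mathbb{N}_0$ let $\mathsf{t}^\ell:\mathbb{S}^3\to\mathbb{C}^{(2\ell+1)\times(2\ell+1)}$, with matrix entries indexed by $m,n\in\{-\ell,-\ell+1,\dots,\ell\}$, be a unitary matrix representative of the class of continuous irreducible representations of $\mathbb{S}^3$ of dimension $2\ell+1$. Let $X$ be a left-invariant vector field on $\mathbb{S}^3$, $(Xf)(x)=\frac{d}{ds}f(x\exp(sX))|_{s=0}$, normalized so that, for this choice of the $\mathsf{t}^\ell$, it has the symbol $$\sigma_X(\ell)_{mn}:=\big(\mathsf{t}^\ell(x)^*(X\mathsf{t}^\ell)(x)\big)_{mn}=im\,\delta_{mn},\qquad x\in\mathbb{S}^3,\ -\ell\le m,n\le\ell,\ \ell\in\tfrac12\mathbb{N}_0 .$$ Let $a\in C^\infty(\mathbb{T}^1)$ be real-valued, and put $$a_0=\frac1{2\pi}\int_0^{2\pi}a(t)\,dt,\qquad A(t)=\int_0^t a(s)\,ds-a_0t,\qquad L=\partial_t+a(t)X,\qquad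 L_{a_0}=\partial_t+a_0X .$$ For a smooth function or a distribution $u$ on $\mathbb{T}^1\times\mathbb{S}^3$ put $$\Psi_a u(t,x)=\sum_{\ell\in\frac12\mathbb{N}_0}(2\ell+1)\sum_{m,n=-\ell}^{\ell}e^{imA(t)}\,\widehat u(t,\ell)_{mn}\,\mathsf{t}^\ell(x)_{nm},$$ where $\widehat u(t,\ell)_{mn}=\int_{\mathbb{S}^3}u(t,x)\overline{\mathsf{t}^\ell(x)_{nm}}\,dx$ if $u$ is smooth, and where $\widehat u(\cdot,\ell)_{mn}$ is the distribution $\psi\mapsto\langle u,\psi\times\overline{\mathsf{t}^\ell_{nm}}\rangle$ on $\mathbb{T}^1$ if $u\in\mathcal{D}'(\mathbb{T}^1\times\mathbb{S}^3)$. Derivatives and products with smooth functions are taken on distributions by duality: $\langle\partial_tu,\varphi\rangle=-\langle u,\partial_t\varphi\rangle$, $\langle Xu,\varphi\rangle=-\langle u,X\varphi\rangle$, $\langle gu,\varphi\rangle=\langle u,g\varphi\rangle$. Then the series over $\ell$ converges (at every point if $u$ is smooth, and when tested against every $\varphi\in C^\infty(\mathbb{T}^1\times\mathbb{S}^3)$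 if $u$ is a distribution), $\Psi_a$ is a linear automorphism of $C^\infty(\mathbb{T}^1\times\mathbb{S}^3)$ and of $\mathcal{D}'(\mathbb{T}^1\times\mathbb{S}^3)$, and $$\Psi_a\circ L=L_{a_0}\circ\Psi_a$$ on $C^\infty(\mathbb{T}^1\times\mathbb{S}^3)$ and on $\mathcal{D}'(\mathbb{T}^1\times\mathbb{S}^3)$. Thus $L$ is conjugate to its constant-coefficient normal form $L_{a_0}$. -/

import Mathlib

open scoped Quaternion Manifold ContDiff
open MeasureTheory

noncomputable section

namespace TorusSphere

/-! ## The group `S³` of unit quaternions, its Haar measure, its Lie algebra -/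

/-- The three-sphere, as the group of unit quaternions (with the quaternionic product). -/
abbrev S3 : Type := Metric.sphere (0 : ℍ[ℝ]) 1

instance factFinrankQuaternion : Fact (Module.finrank ℝ ℍ[ℝ] = 3 + 1) :=
  ⟨Quaternion.finrank_eq_four⟩

instance measurableSpaceS3 : MeasurableSpace S3 := borel S3

instance borelSpaceS3 : BorelSpace S3 := ⟨rfl⟩

/-- The normalized Haar measure of `S³` (total mass `1`). -/
def haarS3 : Measure S3 := Measure.haarMeasure ⊤

/-- The Lie algebra of `S³`: the purely imaginary quaternions. -/
def imH : Submodule ℝ ℍ[ℝ] where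
  carrier := {q | q.re = 0}
  add_mem' := by
    intro a b ha hb
    simp only [Set.mem_ofPred_eq] at *
    simp [ha, hb]
  zero_mem' := by simp
  smul_mem' := by
    intro c a ha
    simp only [Set.mem_ofPred_eq] at *
    simp [ha]

/-- The exponential map of `S³`. -/
def expS3 (X : imH) : S3 :=
  ⟨NormedSpace.exp (X : ℍ[ℝ]), by
    have h : (X : ℍ[ℝ]).re = 0 := X.2
    rw [mem_sphere_zero_iff_norm, Quaternion.norm_exp, h]
    simp⟩

/-- The basis `i, j, k` of the Lie algebra of `S³`. -/
def basisH : Fin 3 → imH :=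
  ![⟨⟨0, 1, 0, 0⟩, rfl⟩, ⟨⟨0, 0, 1, 0⟩, rfl⟩, ⟨⟨0, 0, 0, 1⟩, rfl⟩]

lemma contMDiff_mulS3 :
    ContMDiff ((𝓡 3).prod (𝓡 3)) (𝓡 3) ∞ (fun p : S3 × S3 => p.1 * p.2) := by
  have h1 : ContMDiff ((𝓡 3).prod (𝓡 3)) 𝓘(ℝ, ℍ[ℝ]) ∞
      (fun p : S3 × S3 => (p.1 : ℍ[ℝ]) * (p.2 : ℍ[ℝ])) := by
    have hm : ContDiff ℝ ∞ (fun q : ℍ[ℝ] × ℍ[ℝ] => q.1 * q.2) := contDiff_fst.mul contDiff_snd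
    exact hm.contMDiff.comp
      ((contMDiff_coe_sphere.comp contMDiff_fst).prodMk_space
        (contMDiff_coe_sphere.comp contMDiff_snd))
  exact h1.codRestrict_sphere (fun p => (p.1 * p.2).2)

lemma contMDiff_expS3 : ContMDiff 𝓘(ℝ, imH) (𝓡 3) ∞ expS3 := by
  have h1 : ContDiff ℝ ∞ (fun X : imH => NormedSpace.exp (X : ℍ[ℝ])) := by
    have he : ContDiff ℝ ∞ (NormedSpace.exp : ℍ[ℝ] → ℍ[ℝ]) :=
      contDiff_iff_contDiffAt.2 fun x => (NormedSpace.exp_analytic (𝕂 := ℝ) x).contDiffAt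
    exact he.comp imH.subtypeL.contDiff
  exact h1.contMDiff.codRestrict_sphere (fun X => (expS3 X).2)

lemma eq_sum_basisH (X : imH) :
    X = (X : ℍ[ℝ]).imI • basisH 0 + (X : ℍ[ℝ]).imJ • basisH 1 + (X : ℍ[ℝ]).imK • basisH 2 := by
  have h : (X : ℍ[ℝ]).re = 0 := X.2
  apply Subtype.ext
  simp only [basisH, Submodule.coe_add, Submodule.coe_smul]
  ext
  · rw [h]; change (0 : ℝ) = _ * 0 + _ * 0 + _ * 0; ring
  · change _ = (X : ℍ[ℝ]).imI * 1 + (X : ℍ[ℝ]).imJ * 0 + (X : ℍ[ℝ]).imK * 0; ring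
  · change _ = (X : ℍ[ℝ]).imI * 0 + (X : ℍ[ℝ]).imJ * 1 + (X : ℍ[ℝ]).imK * 0; ring
  · change _ = (X : ℍ[ℝ]).imI * 0 + (X : ℍ[ℝ]).imJ * 0 + (X : ℍ[ℝ]).imK * 1; ring

lemma contMDiff_mulC {E H M : Type*} [NormedAddCommGroup E] [NormedSpace ℝ E] [TopologicalSpace H]
    {I : ModelWithCorners ℝ E H} [TopologicalSpace M] [ChartedSpace H M] {f g : M → ℂ}
    (hf : ContMDiff I 𝓘(ℝ, ℂ) ∞ f) (hg : ContMDiff I 𝓘(ℝ, ℂ) ∞ g) :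
    ContMDiff I 𝓘(ℝ, ℂ) ∞ (fun x => f x * g x) := by
  have hm : ContDiff ℝ ∞ (fun q : ℂ × ℂ => q.1 * q.2) := contDiff_fst.mul contDiff_snd
  exact hm.contMDiff.comp (hf.prodMk_space hg)

/-! ## Smooth functions on `𝕋¹`, `S³` and `𝕋¹ × S³`, where `𝕋¹ = ℝ / 2πℤ`

Functions on `𝕋¹` are identified with `2π`-periodic functions of `t ∈ ℝ`. -/

/-- `C^∞(𝕋¹)`, with real or complex values. -/
def smoothT (𝕜 : Type) [RCLike 𝕜] : Submodule 𝕜 (ℝ → 𝕜) where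
  carrier := {f | Function.Periodic f (2 * Real.pi) ∧ ContDiff ℝ ∞ f}
  add_mem' := fun ha hb => ⟨ha.1.add hb.1, ha.2.add hb.2⟩
  zero_mem' := ⟨fun _ => rfl, contDiff_const⟩
  smul_mem' := fun c f hf =>
    ⟨fun t => by simp [hf.1 t], contDiff_const.mul hf.2⟩

/-- `C^∞(𝕋¹)` with complex values. -/
abbrev CT : Type := smoothT ℂ

/-- `C^∞(𝕋¹)` with real values. -/
abbrev RT : Type := smoothT ℝ

/-- `C^∞(S³)`. -/
def smoothS : Submodule ℂ (S3 → ℂ) where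
  carrier := {f | ContMDiff (𝓡 3) 𝓘(ℝ, ℂ) ∞ f}
  add_mem' := fun ha hb => ha.add hb
  zero_mem' := contMDiff_const
  smul_mem' := fun _ _ hf => contMDiff_mulC contMDiff_const hf

abbrev CS : Type := smoothS

lemma contMDiff_of_CS (g : CS) : ContMDiff (𝓡 3) 𝓘(ℝ, ℂ) ∞ g.1 := by
  have h := g.2
  exact h

/-- `C^∞(𝕋¹ × S³)` as a subspace of all complex functions on `ℝ × S³`. -/
def smoothTS : Submodule ℂ (ℝ × S3 → ℂ) where
  carrier := {f | (∀ t x, f (t + 2 * Real.pi, x) = f (t, x)) ∧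
    ContMDiff (𝓘(ℝ, ℝ).prod (𝓡 3)) 𝓘(ℝ, ℂ) ∞ f}
  add_mem' := fun ha hb => ⟨fun t x => by simp [ha.1 t x, hb.1 t x], ha.2.add hb.2⟩
  zero_mem' := ⟨fun _ _ => rfl, contMDiff_const⟩
  smul_mem' := fun c f hf =>
    ⟨fun t x => by simp [hf.1 t x], contMDiff_mulC contMDiff_const hf.2⟩

/-- `C^∞(𝕋¹ × S³)`. This is a new type, so that it does not inherit the topology of pointwise
convergence; its Fréchet topology is introduced below. -/
def CTS : Type := smoothTS

instance : AddCommGroup CTS := inferInstanceAs (AddCommGroup smoothTS)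

instance : Module ℂ CTS := inferInstanceAs (Module ℂ smoothTS)

namespace CTS

instance : FunLike CTS (ℝ × S3) ℂ where
  coe f := f.1
  coe_injective := fun _ _ h => Subtype.ext h

/-- Build an element of `C^∞(𝕋¹ × S³)`. -/
def mk (f : ℝ × S3 → ℂ) (hp : ∀ t x, f (t + 2 * Real.pi, x) = f (t, x))
    (hf : ContMDiff (𝓘(ℝ, ℝ).prod (𝓡 3)) 𝓘(ℝ, ℂ) ∞ f) : CTS := ⟨f, by exact ⟨hp, hf⟩⟩

@[simp] lemma mk_apply (f : ℝ × S3 → ℂ) (hp hf) (p : ℝ × S3) : mk f hp hf p = f p := rfl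

@[simp] lemma add_apply (f g : CTS) (p : ℝ × S3) : (f + g) p = f p + g p := rfl

@[simp] lemma smul_apply (c : ℂ) (f : CTS) (p : ℝ × S3) : (c • f) p = c * f p := rfl

lemma periodic (f : CTS) (t : ℝ) (x : S3) : f (t + 2 * Real.pi, x) = f (t, x) := by
  have h : (f : ℝ × S3 → ℂ) ∈ smoothTS := f.2
  exact h.1 t x

lemma contMDiff (f : CTS) : ContMDiff (𝓘(ℝ, ℝ).prod (𝓡 3)) 𝓘(ℝ, ℂ) ∞ f := by
  have h : (f : ℝ × S3 → ℂ) ∈ smoothTS := f.2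
  exact h.2

@[ext] lemma ext {f g : CTS} (h : ∀ p, f p = g p) : f = g := DFunLike.ext f g h

end CTS

/-! ## Derivatives -/

/-- A derivative in a real parameter of a smooth function is smooth. -/
lemma contMDiff_deriv_param {G : (ℝ × S3) × ℝ → ℂ}
    (hG : ContMDiff ((𝓘(ℝ, ℝ).prod (𝓡 3)).prod 𝓘(ℝ, ℝ)) 𝓘(ℝ, ℂ) ∞ G) :
    ContMDiff (𝓘(ℝ, ℝ).prod (𝓡 3)) 𝓘(ℝ, ℂ) ∞ (fun p => deriv (fun s => G (p, s)) 0) := by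
  intro p
  have h := ContMDiffAt.mfderiv_apply (m := ∞) (n := ∞) (I := 𝓘(ℝ, ℝ)) (I' := 𝓘(ℝ, ℂ))
    (J := 𝓘(ℝ, ℝ).prod (𝓡 3)) (J' := 𝓘(ℝ, ℝ).prod (𝓡 3)) (x₀ := p)
    (fun p s => G (p, s)) (fun _ => (0 : ℝ)) id (fun _ => (1 : ℝ)) hG.contMDiffAt
    contMDiffAt_const contMDiffAt_id contMDiffAt_const (by simp)
  simpa [inTangentCoordinates_model_space, mfderiv_eq_fderiv] using h

lemma CTS.contMDiff_flow (f : CTS) (X : imH) :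
    ContMDiff ((𝓘(ℝ, ℝ).prod (𝓡 3)).prod 𝓘(ℝ, ℝ)) 𝓘(ℝ, ℂ) ∞
      (fun q : (ℝ × S3) × ℝ => f (q.1.1, q.1.2 * expS3 (q.2 • X))) := by
  have hs : ContDiff ℝ ∞ (fun s : ℝ => s • X) := contDiff_id.smul contDiff_const
  have he : ContMDiff 𝓘(ℝ, ℝ) (𝓡 3) ∞ (fun s : ℝ => expS3 (s • X)) :=
    contMDiff_expS3.comp hs.contMDiff
  exact f.contMDiff.comp ((contMDiff_fst.comp contMDiff_fst).prodMk
    (contMDiff_mulS3.comp ((contMDiff_snd.comp contMDiff_fst).prodMk (he.comp contMDiff_snd))))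

lemma CTS.contMDiff_shift (f : CTS) :
    ContMDiff ((𝓘(ℝ, ℝ).prod (𝓡 3)).prod 𝓘(ℝ, ℝ)) 𝓘(ℝ, ℂ) ∞
      (fun q : (ℝ × S3) × ℝ => f (q.1.1 + q.2, q.1.2)) := by
  exact f.contMDiff.comp (((contMDiff_fst.comp contMDiff_fst).add contMDiff_snd).prodMk
    (contMDiff_snd.comp contMDiff_fst))

lemma CTS.differentiable_flow (f : CTS) (X : imH) (t : ℝ) (x : S3) :
    Differentiable ℝ (fun s : ℝ => f (t, x * expS3 (s • X))) := by
  have h : ContMDiff 𝓘(ℝ, ℝ) 𝓘(ℝ, ℂ) ∞ (fun s : ℝ => f (t, x * expS3 (s • X))) :=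
    (f.contMDiff_flow X).comp ((contMDiff_const (c := (t, x))).prodMk contMDiff_id)
  exact h.contDiff.differentiable (by simp)

lemma CTS.contDiff_fst (f : CTS) (x : S3) : ContDiff ℝ ∞ (fun t : ℝ => f (t, x)) :=
  ContMDiff.contDiff (f.contMDiff.comp (contMDiff_id.prodMk contMDiff_const))

lemma CTS.differentiable_fst (f : CTS) (x : S3) : Differentiable ℝ (fun t : ℝ => f (t, x)) :=
  (f.contDiff_fst x).differentiable (by simp)

/-- `∂_t` on `C^∞(𝕋¹ × S³)`. -/
def dt : CTS →ₗ[ℂ] CTS where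
  toFun f := CTS.mk (fun p => deriv (fun t => f (t, p.2)) p.1)
    (fun t x => by
      have h : (fun s => f (s, x)) = fun s => (fun r => f (r, x)) (s + 2 * Real.pi) := by
        funext s; exact (f.periodic s x).symm
      change deriv (fun s => f (s, x)) (t + 2 * Real.pi) = deriv (fun s => f (s, x)) t
      conv_rhs => rw [h]
      exact (deriv_comp_add_const (fun r => f (r, x)) (2 * Real.pi) t).symm)
    (by
      have h := contMDiff_deriv_param f.contMDiff_shift
      convert h using 2 with p
      have := deriv_comp_const_add (fun t => f (t, p.2)) p.1 0
      simp only [add_zero] at this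
      exact this.symm)
  map_add' f g := by
    ext p
    exact deriv_fun_add (f.differentiable_fst p.2 _) (g.differentiable_fst p.2 _)
  map_smul' c f := by
    ext p
    exact deriv_const_mul c (f.differentiable_fst p.2 _)

/-- The left-invariant vector field on `S³` given by `X`, acting on `C^∞(𝕋¹ × S³)` in the second
variable: `(X f)(t, x) = d/ds f(t, x exp(sX))` at `s = 0`. -/
def dX (X : imH) : CTS →ₗ[ℂ] CTS where
  toFun f := CTS.mk (fun p => deriv (fun s : ℝ => f (p.1, p.2 * expS3 (s • X))) 0)
    (fun t x => by simp only [f.periodic])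
    (contMDiff_deriv_param (f.contMDiff_flow X))
  map_add' f g := by
    ext p
    exact deriv_fun_add (f.differentiable_flow X _ _ _) (g.differentiable_flow X _ _ _)
  map_smul' c f := by
    ext p
    exact deriv_const_mul c (f.differentiable_flow X _ _ _)

/-- Multiplication of a function on `𝕋¹ × S³` by a smooth function of `t ∈ 𝕋¹`. -/
def mulT (g : CT) : CTS →ₗ[ℂ] CTS where
  toFun f := CTS.mk (fun p => g.1 p.1 * f p)
    (fun t x => by simp only [f.periodic, g.2.1 t])
    (contMDiff_mulC (g.2.2.contMDiff.comp contMDiff_fst) f.contMDiff)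
  map_add' f h := by ext p; simp [mul_add]
  map_smul' c f := by ext p; simp [mul_left_comm]

@[simp] lemma dt_apply (f : CTS) (p : ℝ × S3) :
    dt f p = deriv (fun t => f (t, p.2)) p.1 := rfl

@[simp] lemma dX_apply (X : imH) (f : CTS) (p : ℝ × S3) :
    dX X f p = deriv (fun s : ℝ => f (p.1, p.2 * expS3 (s • X))) 0 := rfl

@[simp] lemma mulT_apply (g : CT) (f : CTS) (p : ℝ × S3) : mulT g f p = g.1 p.1 * f p := rfl

/-! ## The Fréchet topology of `C^∞(𝕋¹ × S³)` and distributions -/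

lemma CTS.exists_bound (f : CTS) : ∃ C, ∀ p, ‖f p‖ ≤ C := by
  have hc : IsCompact (Set.Icc (0 : ℝ) (2 * Real.pi) ×ˢ (Set.univ : Set S3)) :=
    isCompact_Icc.prod isCompact_univ
  obtain ⟨C, hC⟩ := hc.exists_bound_of_continuousOn f.contMDiff.continuous.continuousOn
  refine ⟨C, fun p => ?_⟩
  have hper : Function.Periodic (fun t => f (t, p.2)) (2 * Real.pi) := fun t => f.periodic t p.2
  obtain ⟨y, hy, hy'⟩ := hper.exists_mem_Ico₀ (by positivity) p.1
  have : f p = f (y, p.2) := hy'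
  rw [this]
  exact hC _ ⟨⟨hy.1, hy.2.le⟩, trivial⟩

/-- The inclusion of `C^∞(𝕋¹ × S³)` in the space of bounded continuous functions. -/
def toBCF : CTS →ₗ[ℂ] BoundedContinuousFunction (ℝ × S3) ℂ where
  toFun f := BoundedContinuousFunction.ofNormedAddCommGroup f f.contMDiff.continuous
    f.exists_bound.choose f.exists_bound.choose_spec
  map_add' _ _ := rfl
  map_smul' _ _ := rfl

/-- The left-invariant frame `∂_t, i, j, k` of `𝕋¹ × S³`. -/
def frame : Option (Fin 3) → CTS →ₗ[ℂ] CTS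
  | none => dt
  | some i => dX (basisH i)

/-- The left-invariant differential operator given by a word in the frame. -/
def wordD : List (Option (Fin 3)) → CTS →ₗ[ℂ] CTS
  | [] => LinearMap.id
  | d :: w => wordD w ∘ₗ frame d

/-- The seminorms `f ↦ sup |∂^w f|`, where `∂^w` runs through all compositions of fields of the
left-invariant frame. -/
def seminormTS : SeminormFamily ℂ CTS (List (Option (Fin 3))) := fun w =>
  (normSeminorm ℂ (BoundedContinuousFunction (ℝ × S3) ℂ)).comp (toBCF ∘ₗ wordD w)

/-- The usual Fréchet topology of `C^∞(𝕋¹ × S³)`: uniform convergence of all derivatives. -/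
instance topologyTS : TopologicalSpace CTS := seminormTS.moduleFilterBasis.topology

lemma withSeminormsTS : WithSeminorms seminormTS := ⟨rfl⟩

instance : IsTopologicalAddGroup CTS := withSeminormsTS.topologicalAddGroup

instance : ContinuousSMul ℂ CTS := withSeminormsTS.continuousSMul

/-- Distributions on `𝕋¹ × S³`: continuous linear functionals on `C^∞(𝕋¹ × S³)`. -/
abbrev Distr : Type := CTS →L[ℂ] ℂ

lemma continuous_iff_wordD {Y : Type*} [AddCommGroup Y] [Module ℂ Y] [TopologicalSpace Y]
    [IsTopologicalAddGroup Y] (T : Y →ₗ[ℂ] CTS) :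
    Continuous T ↔ ∀ w, Continuous fun y => toBCF (wordD w (T y)) := by
  constructor
  · intro hT w
    have h : Continuous (toBCF ∘ₗ wordD w) :=
      continuous_of_continuousAt_zero (toBCF ∘ₗ wordD w) (by
        have h0 := (withSeminormsTS.continuous_seminorm w).tendsto 0
        rw [map_zero] at h0
        rw [ContinuousAt, map_zero]
        exact tendsto_zero_iff_norm_tendsto_zero.2 h0)
    exact h.comp hT
  · intro h
    refine continuous_of_continuousAt_zero T ?_
    rw [ContinuousAt, map_zero, withSeminormsTS.tendsto_nhds]
    intro w ε hε
    have h0 := (h w).tendsto 0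
    simp only [map_zero] at h0
    have h1 := (tendsto_zero_iff_norm_tendsto_zero.1 h0).eventually (gt_mem_nhds hε)
    filter_upwards [h1] with y hy
    simpa [seminormTS] using hy

lemma continuous_wordD (w : List (Option (Fin 3))) :
    Continuous fun f => toBCF (wordD w f) :=
  (continuous_iff_wordD (LinearMap.id : CTS →ₗ[ℂ] CTS)).1 continuous_id w

lemma continuous_frame (d : Option (Fin 3)) : Continuous (frame d) :=
  (continuous_iff_wordD _).2 fun w => continuous_wordD (d :: w)

lemma continuous_dt : Continuous dt := continuous_frame none

/-- The derivative of `f` along the left-invariant field `X` depends linearly on `X`. -/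
lemma dX_eq_sum (X : imH) (f : CTS) :
    dX X f = ((X : ℍ[ℝ]).imI : ℂ) • frame (some 0) f + ((X : ℍ[ℝ]).imJ : ℂ) • frame (some 1) f
      + ((X : ℍ[ℝ]).imK : ℂ) • frame (some 2) f := by
  ext ⟨t, x⟩
  have hF : Differentiable ℝ (fun Y : imH => f (t, x * expS3 Y)) := by
    have h : ContMDiff 𝓘(ℝ, imH) 𝓘(ℝ, ℂ) ∞ (fun Y : imH => f (t, x * expS3 Y)) :=
      f.contMDiff.comp (contMDiff_const.prodMk
        (contMDiff_mulS3.comp (contMDiff_const.prodMk contMDiff_expS3)))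
    exact h.contDiff.differentiable (by simp)
  have key : ∀ Y : imH, dX Y f (t, x) = fderiv ℝ (fun Y : imH => f (t, x * expS3 Y)) 0 Y := by
    intro Y
    rw [dX_apply]
    have h1 : HasDerivAt (fun s : ℝ => s • Y) Y 0 := by
      simpa using (hasDerivAt_id (0 : ℝ)).smul_const Y
    have h2 : HasFDerivAt (fun Y : imH => f (t, x * expS3 Y))
        (fderiv ℝ (fun Y : imH => f (t, x * expS3 Y)) 0) ((0 : ℝ) • Y) := by
      rw [zero_smul]; exact (hF 0).hasFDerivAt
    exact (h2.comp_hasDerivAt (0 : ℝ) h1).deriv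
  simp only [CTS.add_apply, CTS.smul_apply, frame, key]
  conv_lhs => rw [eq_sum_basisH X]
  simp only [map_add, map_smul, Complex.real_smul]

lemma continuous_dX (X : imH) : Continuous (dX X) := by
  have h : (dX X : CTS → CTS) = fun f => ((X : ℍ[ℝ]).imI : ℂ) • frame (some 0) f
      + ((X : ℍ[ℝ]).imJ : ℂ) • frame (some 1) f + ((X : ℍ[ℝ]).imK : ℂ) • frame (some 2) f :=
    funext (dX_eq_sum X)
  rw [h]
  have hc : ∀ (c : ℂ) d, Continuous fun f => c • frame d f := fun c d =>
    (continuous_frame d).const_smul c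
  exact ((hc _ _).add (hc _ _)).add (hc _ _)

/-- The derivative of a smooth function on `𝕋¹`. -/
def derivT (g : CT) : CT :=
  ⟨deriv g.1, fun t => by
      have h : g.1 = fun s => g.1 (s + 2 * Real.pi) := funext fun s => (g.2.1 s).symm
      conv_rhs => rw [h]
      rw [deriv_comp_add_const],
    (contDiff_infty_iff_deriv.1 g.2.2).2⟩

lemma dt_mulT (g : CT) (f : CTS) : dt (mulT g f) = mulT (derivT g) f + mulT g (dt f) := by
  ext p
  exact deriv_fun_mul ((g.2.2.differentiable (by simp)) p.1) (f.differentiable_fst p.2 p.1)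

lemma dX_mulT (X : imH) (g : CT) (f : CTS) : dX X (mulT g f) = mulT g (dX X f) := by
  ext p
  exact deriv_const_mul (g.1 p.1) (f.differentiable_flow X p.1 p.2 0)

lemma continuous_mulT (g : CT) : Continuous (mulT g) := by
  rw [continuous_iff_wordD]
  have key : ∀ (w : List (Option (Fin 3))) (g : CT),
      Continuous fun f => toBCF (wordD w (mulT g f)) := by
    intro w
    induction w with
    | nil =>
      intro g
      obtain ⟨C, hC⟩ : ∃ C, ∀ p : ℝ × S3, ‖g.1 p.1‖ ≤ C := by
        let one : CTS := CTS.mk (fun _ => 1) (fun _ _ => rfl) contMDiff_const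
        obtain ⟨C, hC⟩ := (mulT g one).exists_bound
        exact ⟨C, fun p => by simpa [one] using hC p⟩
      have hgc : Continuous fun p : ℝ × S3 => g.1 p.1 := g.2.2.continuous.comp continuous_fst
      let G : BoundedContinuousFunction (ℝ × S3) ℂ :=
        BoundedContinuousFunction.ofNormedAddCommGroup _ hgc C hC
      have h : (fun f => toBCF (wordD [] (mulT g f))) = fun f => G * toBCF (wordD [] f) := rfl
      rw [h]
      exact continuous_const.mul (continuous_wordD [])
    | cons d w ih =>
      intro g
      cases d with
      | none =>
        have h : (fun f => toBCF (wordD (none :: w) (mulT g f))) = fun f =>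
            toBCF (wordD w (mulT (derivT g) f)) + toBCF (wordD w (mulT g (dt f))) := by
          funext f
          rw [← map_add, ← map_add, ← dt_mulT]
          rfl
        rw [h]
        exact (ih _).add ((ih g).comp continuous_dt)
      | some i =>
        have h : (fun f => toBCF (wordD (some i :: w) (mulT g f))) = fun f =>
            toBCF (wordD w (mulT g (dX (basisH i) f))) := by
          funext f
          rw [← dX_mulT]
          rfl
        rw [h]
        exact (ih g).comp (continuous_dX _)
  exact fun w => key w g

/-- `∂_t` on distributions: `⟨∂_t u, φ⟩ = -⟨u, ∂_t φ⟩`. -/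
def dtD (u : Distr) : Distr := -(u.comp ⟨dt, continuous_dt⟩)

/-- A left-invariant field `X` on distributions: `⟨X u, φ⟩ = -⟨u, X φ⟩`. -/
def dXD (X : imH) (u : Distr) : Distr := -(u.comp ⟨dX X, continuous_dX X⟩)

/-- Multiplication of a distribution by a smooth function of `t`: `⟨g u, φ⟩ = ⟨u, g φ⟩`. -/
def mulTD (g : CT) (u : Distr) : Distr := u.comp ⟨mulT g, continuous_mulT g⟩

/-! ## The operators `L = ∂_t + a(t) X` -/

/-- A real-valued smooth function on `𝕋¹`, viewed as complex-valued. -/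
def RT.toComplex (a : RT) : CT :=
  ⟨fun t => (a.1 t : ℂ), fun t => by simp only [a.2.1 t], Complex.ofRealCLM.contDiff.comp a.2.2⟩

/-- The constant function `c` on `𝕋¹`. -/
def RT.const (c : ℝ) : RT := ⟨fun _ => c, fun _ => rfl, contDiff_const⟩

/-- `∂_t + a(t) X` on `C^∞(𝕋¹ × S³)`. -/
def opL (a : RT) (X : imH) (u : CTS) : CTS := dt u + mulT (RT.toComplex a) (dX X u)

/-- `∂_t + a(t) X` on `𝓓'(𝕋¹ × S³)`. -/
def opLD (a : RT) (X : imH) (u : Distr) : Distr := dtD u + mulTD (RT.toComplex a) (dXD X u)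

/-- The mean `a₀` of `a`. -/
def mean (a : RT) : ℝ := 1 / (2 * Real.pi) * ∫ t in (0 : ℝ)..(2 * Real.pi), a.1 t

/-- `A(t) = ∫₀ᵗ a(s) ds - a₀ t`. -/
def primA (a : RT) (t : ℝ) : ℝ := (∫ s in (0 : ℝ)..t, a.1 s) - mean a * t

lemma contDiff_primA (a : RT) : ContDiff ℝ ∞ (primA a) := by
  have hc : Continuous a.1 := a.2.2.continuous
  have h1 : ContDiff ℝ ∞ (fun t : ℝ => ∫ s in (0 : ℝ)..t, a.1 s) := by
    rw [contDiff_infty_iff_deriv]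
    refine ⟨fun t => (hc.integral_hasStrictDerivAt 0 t).hasDerivAt.differentiableAt, ?_⟩
    have : deriv (fun t : ℝ => ∫ s in (0 : ℝ)..t, a.1 s) = a.1 :=
      funext fun t => hc.deriv_integral a.1 0 t
    rw [this]
    exact a.2.2
  exact h1.sub (contDiff_const.mul contDiff_id)

lemma periodic_primA (a : RT) : Function.Periodic (primA a) (2 * Real.pi) := by
  intro t
  have hc : Continuous a.1 := a.2.2.continuous
  have h1 : (∫ s in (0 : ℝ)..(t + 2 * Real.pi), a.1 s)
      = (∫ s in (0 : ℝ)..t, a.1 s) + ∫ s in (0 : ℝ)..(2 * Real.pi), a.1 s := by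
    rw [← intervalIntegral.integral_add_adjacent_intervals (hc.intervalIntegrable 0 t)
      (hc.intervalIntegrable t _), a.2.1.intervalIntegral_add_eq t 0, zero_add]
  have h2 : mean a * (2 * Real.pi) = ∫ s in (0 : ℝ)..(2 * Real.pi), a.1 s := by
    have : Real.pi ≠ 0 := Real.pi_ne_zero
    unfold mean
    field_simp
  simp only [primA]
  rw [h1, mul_add, h2]
  ring

/-- The function `e^{i m A(t)}` on `𝕋¹`. -/
def expA (a : RT) (m : ℝ) : CT :=
  ⟨fun t => Complex.exp (Complex.I * m * primA a t),
    fun t => by simp only [periodic_primA a t],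
    (contDiff_const.mul (Complex.ofRealCLM.contDiff.comp (contDiff_primA a))).cexp⟩

/-! ## The unitary dual of `S³`

The irreducible representation of spin `ℓ = k / 2`, of dimension `k + 1 = 2 ℓ + 1`, is realized on
the homogeneous polynomials of degree `k` in `(z₁, z₂)` by `(τ(x) f)(z) = f(z x)`, where the unit
quaternion `x = α + β j` (with `α, β ∈ ℂ`) is identified with the matrix `(α, β; -β̄, ᾱ)` of `SU(2)`.
The orthonormal basis is `z₁^(k - j) z₂^j / √((k - j)! j!)`, with `0 ≤ j ≤ k`.
The index `j` stands for the weight `m = j - ℓ`, from `-ℓ` to `ℓ`. -/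

/-- The weight `m = j - ℓ ∈ {-ℓ, …, ℓ}`, with `ℓ = k / 2`. -/
def weight (k : ℕ) (j : Fin (k + 1)) : ℝ := (j : ℝ) - (k : ℝ) / 2

/-- `α` in `x = α + β j`. -/
def qα (x : S3) : ℂ := ⟨(x : ℍ[ℝ]).re, (x : ℍ[ℝ]).imI⟩

/-- `β` in `x = α + β j`. -/
def qβ (x : S3) : ℂ := ⟨(x : ℍ[ℝ]).imJ, (x : ℍ[ℝ]).imK⟩

open Polynomial in
/-- The image of `z₁^(k - j) z₂^j` under `τ(x)`, dehomogenized by `z₁ = 1`, `z₂ = T`. -/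
def tauPoly (k : ℕ) (x : S3) (j : ℕ) : ℂ[X] :=
  (C (qα x) - C (star (qβ x)) * X) ^ (k - j) * (C (qβ x) + C (star (qα x)) * X) ^ j

/-- The matrix of the representation of spin `k / 2` in the orthonormal monomial basis. -/
def tau (k : ℕ) (x : S3) : Matrix (Fin (k + 1)) (Fin (k + 1)) ℂ := fun i j =>
  (Real.sqrt (((k - i).factorial * (i : ℕ).factorial : ℝ) /
    ((k - j).factorial * (j : ℕ).factorial : ℝ)) : ℂ) * (tauPoly k x j).coeff i

/-- A choice of unitary matrices: it changes each `tau k` into an arbitrary matrix representative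
of its class of unitary equivalence. -/
abbrev Frames : Type := (k : ℕ) → Matrix.unitaryGroup (Fin (k + 1)) ℂ

/-- The matrix representative `t^ℓ`, with `ℓ = k / 2`, of the class of `tau k`. -/
def rep (U : Frames) (k : ℕ) (x : S3) : Matrix (Fin (k + 1)) (Fin (k + 1)) ℂ :=
  (U k : Matrix (Fin (k + 1)) (Fin (k + 1)) ℂ) * tau k x *
    star (U k : Matrix (Fin (k + 1)) (Fin (k + 1)) ℂ)

/-- The matrix symbol `σ_X(x, ℓ) = t^ℓ(x)^* (X t^ℓ)(x)`, with `ℓ = k / 2`. -/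
def symbol (U : Frames) (X : imH) (k : ℕ) (x : S3) : Matrix (Fin (k + 1)) (Fin (k + 1)) ℂ :=
  star (rep U k x) * Matrix.of fun i j => deriv (fun s : ℝ => rep U k (x * expS3 (s • X)) i j) 0

lemma contMDiff_quaternion {f : ℍ[ℝ] → ℂ} (hf : ContDiff ℝ ∞ f) :
    ContMDiff (𝓡 3) 𝓘(ℝ, ℂ) ∞ (fun x : S3 => f x) :=
  hf.contMDiff.comp contMDiff_coe_sphere

lemma contMDiff_of_linear (f : ℍ[ℝ] →ₗ[ℝ] ℂ) :
    ContMDiff (𝓡 3) 𝓘(ℝ, ℂ) ∞ (fun x : S3 => f x) :=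
  contMDiff_quaternion (LinearMap.toContinuousLinearMap f).contDiff

lemma contMDiff_qα : ContMDiff (𝓡 3) 𝓘(ℝ, ℂ) ∞ qα :=
  contMDiff_of_linear
    { toFun := fun q => ⟨q.re, q.imI⟩
      map_add' := fun _ _ => rfl
      map_smul' := fun _ _ => by apply Complex.ext <;> simp }

lemma contMDiff_qβ : ContMDiff (𝓡 3) 𝓘(ℝ, ℂ) ∞ qβ :=
  contMDiff_of_linear
    { toFun := fun q => ⟨q.imJ, q.imK⟩
      map_add' := fun _ _ => rfl
      map_smul' := fun _ _ => by apply Complex.ext <;> simp }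

lemma contMDiff_star {f : S3 → ℂ} (hf : ContMDiff (𝓡 3) 𝓘(ℝ, ℂ) ∞ f) :
    ContMDiff (𝓡 3) 𝓘(ℝ, ℂ) ∞ (fun x => star (f x)) :=
  (Complex.conjCLE.contDiff (n := ∞)).contMDiff.comp hf

/-- Families of polynomials whose coefficients are smooth functions on `S³`. -/
def SmoothCoeff (P : S3 → Polynomial ℂ) : Prop :=
  ∀ n, ContMDiff (𝓡 3) 𝓘(ℝ, ℂ) ∞ (fun x => (P x).coeff n)

lemma SmoothCoeff.mul {P Q : S3 → Polynomial ℂ} (hP : SmoothCoeff P) (hQ : SmoothCoeff Q) :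
    SmoothCoeff (fun x => P x * Q x) := by
  intro n
  simp only [Polynomial.coeff_mul]
  exact contMDiff_finsetSum fun i _ => contMDiff_mulC (hP i.1) (hQ i.2)

lemma SmoothCoeff.pow {P : S3 → Polynomial ℂ} (hP : SmoothCoeff P) (k : ℕ) :
    SmoothCoeff (fun x => P x ^ k) := by
  induction k with
  | zero => intro n; simpa using contMDiff_const
  | succ k ih => simpa only [pow_succ] using ih.mul hP

lemma SmoothCoeff.linear {f g : S3 → ℂ} (hf : ContMDiff (𝓡 3) 𝓘(ℝ, ℂ) ∞ f)
    (hg : ContMDiff (𝓡 3) 𝓘(ℝ, ℂ) ∞ g) :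
    SmoothCoeff (fun x => Polynomial.C (f x) + Polynomial.C (g x) * Polynomial.X) := by
  intro n
  simp only [Polynomial.coeff_add, Polynomial.coeff_C, Polynomial.coeff_C_mul]
  refine ContMDiff.add ?_ (contMDiff_mulC hg contMDiff_const)
  by_cases h : n = 0
  · simpa [h] using hf
  · simpa [h] using contMDiff_const

lemma smoothCoeff_tauPoly (k j : ℕ) : SmoothCoeff (fun x => tauPoly k x j) := by
  refine SmoothCoeff.mul (SmoothCoeff.pow ?_ _)
    (SmoothCoeff.pow (SmoothCoeff.linear contMDiff_qβ (contMDiff_star contMDiff_qα)) _)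
  have h := SmoothCoeff.linear contMDiff_qα
    (contMDiff_mulC (contMDiff_const (c := (-1 : ℂ))) (contMDiff_star contMDiff_qβ))
  simpa [sub_eq_add_neg] using h

lemma contMDiff_rep (U : Frames) (k : ℕ) (i j : Fin (k + 1)) :
    ContMDiff (𝓡 3) 𝓘(ℝ, ℂ) ∞ (fun x => rep U k x i j) := by
  simp only [rep, Matrix.mul_apply]
  exact contMDiff_finsetSum fun l _ => contMDiff_mulC (contMDiff_finsetSum fun r _ =>
    contMDiff_mulC contMDiff_const (contMDiff_mulC contMDiff_const (smoothCoeff_tauPoly k l r)))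
    contMDiff_const

/-- The matrix entry `t^ℓ_{ij}` as an element of `C^∞(S³)`. -/
def repS (U : Frames) (k : ℕ) (i j : Fin (k + 1)) : CS :=
  ⟨fun x => rep U k x i j, by exact contMDiff_rep U k i j⟩

/-- The complex conjugate of `t^ℓ_{ij}` as an element of `C^∞(S³)`. -/
def repConjS (U : Frames) (k : ℕ) (i j : Fin (k + 1)) : CS :=
  ⟨fun x => star (rep U k x i j), by exact contMDiff_star (contMDiff_rep U k i j)⟩

/-! ## Partial Fourier coefficients and the operator `Ψ_a` -/

lemma CTS.continuous_section (f : CTS) (t : ℝ) : Continuous fun x => f (t, x) :=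
  f.contMDiff.continuous.comp (by fun_prop)

instance : IsFiniteMeasure haarS3 :=
  ⟨isCompact_univ.measure_lt_top_of_nhdsWithin fun _ _ => by
    unfold haarS3
    exact (Measure.finiteAt_nhds _ _).filter_mono nhdsWithin_le_nhds⟩

lemma hasDerivAt_integral_section (f : CTS) (g : CS) (t : ℝ) :
    HasDerivAt (fun t => ∫ x, f (t, x) * g.1 x ∂haarS3)
      (∫ x, dt f (t, x) * g.1 x ∂haarS3) t := by
  have hg : Continuous g.1 := (contMDiff_of_CS g).continuous
  have hmeas : ∀ (h : CTS) (s : ℝ),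
      AEStronglyMeasurable (fun x => h (s, x) * g.1 x) haarS3 := fun h s =>
    ((h.continuous_section s).mul hg).aestronglyMeasurable
  obtain ⟨C, hC⟩ := (dt f).exists_bound
  obtain ⟨C', hC'⟩ := f.exists_bound
  obtain ⟨D, hD⟩ := isCompact_univ.exists_bound_of_continuousOn hg.continuousOn
  have hD' : ∀ x, ‖g.1 x‖ ≤ D := fun x => hD x trivial
  have hb : ∀ (h : CTS) (B : ℝ), (∀ p, ‖h p‖ ≤ B) → ∀ s x, ‖h (s, x) * g.1 x‖ ≤ B * D := by
    intro h B hB s x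
    rw [norm_mul]
    exact mul_le_mul (hB _) (hD' x) (norm_nonneg _) ((norm_nonneg _).trans (hB (s, x)))
  refine (hasDerivAt_integral_of_dominated_loc_of_deriv_le (μ := haarS3)
    (F := fun t x => f (t, x) * g.1 x) (F' := fun t x => dt f (t, x) * g.1 x)
    (s := Set.univ) (bound := fun _ => C * D) Filter.univ_mem
    (Filter.Eventually.of_forall fun s => hmeas f s) ?_ (hmeas (dt f) t) ?_
    (integrable_const _) ?_).2
  · exact Integrable.of_bound (hmeas f t) (C' * D)
      (Filter.Eventually.of_forall fun x => hb f C' hC' t x)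
  · exact Filter.Eventually.of_forall fun x s _ => hb (dt f) C hC s x
  · exact Filter.Eventually.of_forall fun x s _ =>
      ((f.differentiable_fst x s).hasDerivAt).mul_const (g.1 x)

lemma contDiff_integral_section (f : CTS) (g : CS) :
    ContDiff ℝ ∞ (fun t => ∫ x, f (t, x) * g.1 x ∂haarS3) := by
  rw [contDiff_infty]
  intro n
  induction n generalizing f with
  | zero =>
    exact contDiff_zero.2
      (continuous_iff_continuousAt.2 fun t => (hasDerivAt_integral_section f g t).continuousAt)
  | succ n ih =>
    have h := ih (dt f)
    push_cast
    rw [contDiff_succ_iff_deriv]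
    refine ⟨fun t => (hasDerivAt_integral_section f g t).differentiableAt, by simp, ?_⟩
    have hd : deriv (fun t => ∫ x, f (t, x) * g.1 x ∂haarS3)
        = fun t => ∫ x, dt f (t, x) * g.1 x ∂haarS3 :=
      funext fun t => (hasDerivAt_integral_section f g t).deriv
    rw [hd]
    exact h

/-- The function `t ↦ ∫_{S³} f(t, x) g(x) dx` on `𝕋¹`. -/
def fiberInt (f : CTS) (g : CS) : CT :=
  ⟨fun t => ∫ x, f (t, x) * g.1 x ∂haarS3, fun t => by simp only [f.periodic],
    contDiff_integral_section f g⟩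

/-- The function `(ψ × g)(t, x) = ψ(t) g(x)`, linear in `ψ`. -/
def tensor (g : CS) : CT →ₗ[ℂ] CTS where
  toFun ψ := CTS.mk (fun p => ψ.1 p.1 * g.1 p.2) (fun t x => by simp only [ψ.2.1 t])
    (contMDiff_mulC (ψ.2.2.contMDiff.comp contMDiff_fst) ((contMDiff_of_CS g).comp contMDiff_snd))
  map_add' f h := by ext p; simp [add_mul]
  map_smul' c f := by ext p; simp [mul_assoc]

/-- The product of two smooth functions on `𝕋¹`. -/
def mulCT (g h : CT) : CT :=
  ⟨fun t => g.1 t * h.1 t, fun t => by simp only [g.2.1 t, h.2.1 t], g.2.2.mul h.2.2⟩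

/-- The partial Fourier coefficient `û(t, ℓ)_{mn} = ∫ u(t, x) conj(t^ℓ(x)_{nm}) dx` of a smooth
function, with `ℓ = k / 2`. -/
def coeff (U : Frames) (u : CTS) (k : ℕ) (m n : Fin (k + 1)) : CT :=
  fiberInt u (repConjS U k n m)

/-- The partial Fourier coefficient `û(·, ℓ)_{mn}` of a distribution, with `ℓ = k / 2`: the linear
functional `ψ ↦ ⟨u, ψ × conj(t^ℓ_{nm})⟩` on `C^∞(𝕋¹)`. -/
def coeffD (U : Frames) (u : Distr) (k : ℕ) (m n : Fin (k + 1)) : CT →ₗ[ℂ] ℂ :=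
  u.toLinearMap ∘ₗ tensor (repConjS U k n m)

/-- The term of index `ℓ = k / 2` of the series that defines `Ψ_a u (t, x)`:
`(2ℓ + 1) ∑_{m, n} e^{i m A(t)} û(t, ℓ)_{mn} t^ℓ(x)_{nm}`. -/
def psiTerm (a : RT) (U : Frames) (u : CTS) (p : ℝ × S3) (k : ℕ) : ℂ :=
  ((k : ℂ) + 1) * ∑ m : Fin (k + 1), ∑ n : Fin (k + 1),
    (expA a (weight k m)).1 p.1 * (coeff U u k m n).1 p.1 * rep U k p.2 n m

/-- The term of index `ℓ = k / 2` of the series that defines `Ψ_a u` for a distribution `u`, namely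
the distribution `(2ℓ + 1) ∑_{m, n} e^{i m A(t)} û(t, ℓ)_{mn} t^ℓ_{nm}`, evaluated at a test
function `φ`. Here a product `v × g` of a functional `v` on `C^∞(𝕋¹)` and of `g ∈ C^∞(S³)` takes the
value `⟨v, ∫ φ(·, x) g(x) dx⟩` at `φ`, and `⟨e^{i m A} v, ψ⟩ = ⟨v, e^{i m A} ψ⟩`. -/
def psiTermD (a : RT) (U : Frames) (u : Distr) (φ : CTS) (k : ℕ) : ℂ :=
  ((k : ℂ) + 1) * ∑ m : Fin (k + 1), ∑ n : Fin (k + 1),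
    coeffD U u k m n (mulCT (expA a (weight k m)) (fiberInt φ (repS U k n m)))

end TorusSphere

end

open TorusSphere

/-!
The operator `Ψ_a` is a translation in disguise. Since `X` has the symbol `i m δ_{mn}`, the matrix
entries satisfy `t^ℓ(x exp (s X))_{nm} = e^{i m s} t^ℓ(x)_{nm}` (`rep_mul_expS3`), so multiplying
`t^ℓ(x)_{nm}` by `e^{i m A(t)}` replaces `x` by `x exp (A(t) X)`. Hence
`Ψ_a u (t, x) = u (t, x exp (A(t) X))` for smooth `u`, and on distributions `Ψ_a` is the transpose
of the inverse translation (`psiTerm_eq`, `psiTermD_eq`). Translations by `A` and `-A` are inverse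
to each other and continuous on `C^∞(𝕋¹ × S³)` (`continuous_pull`), and the chain rule with
`A' = a - a₀` gives the conjugation of `L` to `L_{a₀}` (`opL_pull`), on distributions by duality.

What remains is the convergence of the Fourier series of a smooth function `f` in
`C^∞(𝕋¹ × S³)` (`hasSum_isoProj`). The matrices `t^ℓ` are unitary and multiplicative, and their
characters are `x ↦ U_k (Re x)` with `k = 2ℓ` and `U_k` the Chebyshev polynomial (`trace_tau`).
So, in any frames, the term of index `ℓ` of the series is the convolution of `f` with
`(k + 1) U_k (Re ·)`, which commutes with the left-invariant fields (`wordD_isoProj`). The Chebyshev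
equation says that the characters are eigenfunctions of the Laplacian `Δ` of `S³`: the operator
`1 - Δ` acts on the term as `(k + 1) ^ 2`. Integrating by parts twice, the series of `f` and of all
its derivatives converge normally (`summable_norm_isoProj`). The sum is identified by Abel
summation: the weighted characters `(k + 1) r ^ k U_k (Re ·)` sum to the Poisson kernel
(`hasSum_poisson`), a positive approximate identity (`tendsto_integral_poissonKernelS`). Neither
the Schur orthogonality relations nor the Peter–Weyl theorem is needed.
-/

noncomputable section

namespace TorusSphere

/-! ### The representations `τ_k` are unitary homomorphisms with Chebyshev characters -/

section Representations

open Polynomial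

/-- The value at `(A, B)` of the homogeneous form of degree `n` whose dehomogenization is `p`. -/
def homEval (n : ℕ) (p A B : ℂ[X]) : ℂ[X] :=
  ∑ i ∈ Finset.range (n + 1), C (p.coeff i) * A ^ (n - i) * B ^ i

lemma homEval_linear_mul {n : ℕ} {p : ℂ[X]} (hp : p.natDegree ≤ n) (a b : ℂ) (A B : ℂ[X]) :
    homEval (n + 1) ((C a + C b * X) * p) A B = (C a * A + C b * B) * homEval n p A B := by
  have h0 : p.coeff (n + 1) = 0 := coeff_eq_zero_of_natDegree_lt (by omega)
  have hc : ∀ i, ((C a + C b * X) * p).coeff (i + 1) = a * p.coeff (i + 1) + b * p.coeff i := by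
    intro i
    rw [add_mul, coeff_add, coeff_C_mul, mul_assoc, coeff_C_mul, coeff_X_mul]
  have hc0 : ((C a + C b * X) * p).coeff 0 = a * p.coeff 0 := by simp [mul_coeff_zero]
  have h1 : homEval (n + 1) ((C a + C b * X) * p) A B
      = ∑ i ∈ Finset.range (n + 2), C (a * p.coeff i) * A ^ (n + 1 - i) * B ^ i
        + ∑ i ∈ Finset.range (n + 1), C (b * p.coeff i) * A ^ (n - i) * B ^ (i + 1) := by
    rw [homEval, Finset.sum_range_succ', Finset.sum_range_succ' _ (n + 1), hc0, add_right_comm,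
      ← Finset.sum_add_distrib]
    congr 1
    refine Finset.sum_congr rfl fun i _ => ?_
    rw [hc, C_add, Nat.add_sub_add_right]
    ring
  rw [h1, Finset.sum_range_succ, h0, add_mul, homEval, Finset.mul_sum, Finset.mul_sum]
  simp only [mul_zero, C_0, zero_mul, add_zero]
  refine congrArg₂ (· + ·) ?_ ?_
  · refine Finset.sum_congr rfl fun i hi => ?_
    rw [Nat.sub_add_comm (by simpa [Nat.lt_succ_iff] using hi), C_mul]
    ring
  · refine Finset.sum_congr rfl fun i _ => ?_
    rw [C_mul]
    ring

lemma natDegree_linear_pow_mul_le (a b c d : ℂ) (m n : ℕ) :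
    ((C a + C b * X) ^ m * (C c + C d * X) ^ n).natDegree ≤ m + n := by
  have h : ∀ (a b : ℂ) (m : ℕ), ((C a + C b * X) ^ m).natDegree ≤ m := fun a b m => by
    refine natDegree_pow_le_of_le m (?_ : _ ≤ 1) |>.trans (by simp)
    rw [add_comm]
    exact natDegree_linear_le
  exact natDegree_mul_le.trans (add_le_add (h _ _ _) (h _ _ _))

lemma homEval_linear_pow_mul (a b c d : ℂ) (A B : ℂ[X]) (m n : ℕ) :
    homEval (m + n) ((C a + C b * X) ^ m * (C c + C d * X) ^ n) A B
      = (C a * A + C b * B) ^ m * (C c * A + C d * B) ^ n := by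
  induction m with
  | zero =>
    induction n with
    | zero => simp [homEval]
    | succ n ih =>
      have hd := natDegree_linear_pow_mul_le a b c d 0 n
      simp only [pow_zero, one_mul, zero_add] at *
      rw [pow_succ', homEval_linear_mul hd, ih, pow_succ']
  | succ m ih =>
    rw [pow_succ', mul_assoc, Nat.succ_add,
      homEval_linear_mul (natDegree_linear_pow_mul_le a b c d m n), ih, pow_succ', mul_assoc]

lemma tauPoly_eq (k : ℕ) (x : S3) (j : ℕ) :
    tauPoly k x j = (C (qα x) + C (-star (qβ x)) * X) ^ (k - j)
      * (C (qβ x) + C (star (qα x)) * X) ^ j := by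
  simp [tauPoly, sub_eq_add_neg]

lemma qα_mul (x y : S3) : qα (x * y) = qα x * qα y - qβ x * star (qβ y) := by
  apply Complex.ext <;> simp [qα, qβ, Complex.mul_re, Complex.mul_im] <;> ring

lemma qβ_mul (x y : S3) : qβ (x * y) = qα x * qβ y + qβ x * star (qα y) := by
  apply Complex.ext <;> simp [qα, qβ, Complex.mul_re, Complex.mul_im] <;> ring

/-- Every polynomial `tauPoly k y j` is a form of degree `k`, and `τ(x)` acts by substitution; this
is the multiplicativity of `τ` before normalization. -/
lemma tauPoly_mul (k : ℕ) (x y : S3) (j : Fin (k + 1)) :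
    tauPoly k (x * y) j = ∑ i : Fin (k + 1), C ((tauPoly k y j).coeff i) * tauPoly k x i := by
  have hj : k - (j : ℕ) + j = k := Nat.sub_add_cancel (Nat.lt_succ_iff.1 j.2)
  have h := homEval_linear_pow_mul (qα y) (-star (qβ y)) (qβ y) (star (qα y))
    (C (qα x) + C (-star (qβ x)) * X) (C (qβ x) + C (star (qα x)) * X) (k - j) j
  rw [hj, ← tauPoly_eq, homEval, Finset.sum_range] at h
  simp only [tauPoly_eq k x, ← mul_assoc]
  rw [h, tauPoly_eq, qα_mul, qβ_mul]
  simp only [star_sub, star_add, star_mul', star_star, C_add, C_sub, C_mul, C_neg]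
  congr 2 <;> ring

/-- The squared norm `(k - i)! i!` of the monomial `z₁^(k - i) z₂^i`. -/
def monomialWeight (k : ℕ) (i : ℕ) : ℝ := (k - i).factorial * (i.factorial : ℝ)

lemma monomialWeight_pos (k i : ℕ) : 0 < monomialWeight k i := by
  unfold monomialWeight; positivity

lemma tau_apply (k : ℕ) (x : S3) (i j : Fin (k + 1)) :
    tau k x i j = (Real.sqrt (monomialWeight k i) : ℂ) * (tauPoly k x j).coeff i
      / (Real.sqrt (monomialWeight k j) : ℂ) := by
  have h : tau k x i j = (Real.sqrt (monomialWeight k i / monomialWeight k j) : ℂ)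
      * (tauPoly k x j).coeff i := rfl
  rw [h, Real.sqrt_div (monomialWeight_pos k i).le]
  push_cast
  ring

lemma sqrt_monomialWeight_ne_zero (k i : ℕ) : (Real.sqrt (monomialWeight k i) : ℂ) ≠ 0 := by
  exact_mod_cast (Real.sqrt_pos.2 (monomialWeight_pos k i)).ne'

lemma tau_mul (k : ℕ) (x y : S3) : tau k (x * y) = tau k x * tau k y := by
  ext i j
  rw [Matrix.mul_apply, tau_apply, tauPoly_mul, finsetSum_coeff, Finset.mul_sum, Finset.sum_div]
  refine Finset.sum_congr rfl fun l _ => ?_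
  have := sqrt_monomialWeight_ne_zero k l
  rw [tau_apply, tau_apply, coeff_C_mul]
  field_simp

/-- The matrix of the substitution given by a `2 × 2` matrix and that of its transpose agree, up to
binomial weights: both sides are coefficients of `(a + b T + c S + d S T) ^ k`. -/
lemma choose_mul_coeff_linear_pow (a b c d : ℂ) {k i j : ℕ} (hi : i ≤ k) (hj : j ≤ k) :
    (k.choose i : ℂ) * ((C a + C b * X) ^ (k - i) * (C c + C d * X) ^ i).coeff j
      = (k.choose j : ℂ) * ((C a + C c * X) ^ (k - j) * (C b + C d * X) ^ j).coeff i := by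
  have hexp : ∀ P Q : ℂ[X], (P + Q * X) ^ k
      = ∑ r ∈ Finset.range (k + 1), C (k.choose r : ℂ) * (P ^ (k - r) * Q ^ r * X ^ r) := by
    intro P Q
    rw [add_comm, add_pow]
    refine Finset.sum_congr rfl fun r _ => ?_
    rw [mul_pow, C_eq_natCast]
    ring
  have hpoly : (∑ r ∈ Finset.range (k + 1), C ((k.choose r : ℂ)
        * ((C a + C b * X) ^ (k - r) * (C c + C d * X) ^ r).coeff j) * X ^ r)
      = C (k.choose j : ℂ) * ((C a + C c * X) ^ (k - j) * (C b + C d * X) ^ j) := by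
    refine Polynomial.funext fun s => ?_
    have e1 : ((C (a + c * s) + C (b + d * s) * X) ^ k).coeff j
        = (k.choose j : ℂ) * ((a + c * s) ^ (k - j) * (b + d * s) ^ j) := by
      rw [hexp, finsetSum_coeff, Finset.sum_eq_single j]
      · simp only [← C_pow, ← C_mul, coeff_C_mul, coeff_X_pow, if_true, mul_one]
      · intro r _ hr
        simp only [← C_pow, ← C_mul, coeff_C_mul, coeff_X_pow, if_neg hr.symm, mul_zero]
      · intro h
        exact absurd (Finset.mem_range.2 (Nat.lt_succ_of_le hj)) h
    have e2 : (C (a + c * s) + C (b + d * s) * X) ^ k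
        = ∑ r ∈ Finset.range (k + 1), C ((k.choose r : ℂ) * s ^ r)
          * ((C a + C b * X) ^ (k - r) * (C c + C d * X) ^ r) := by
      have : (C (a + c * s) + C (b + d * s) * X : ℂ[X])
          = (C c + C d * X) * C s + (C a + C b * X) := by
        simp only [C_add, C_mul]; ring
      rw [this, add_pow]
      refine Finset.sum_congr rfl fun r _ => ?_
      rw [mul_pow, C_mul, C_eq_natCast, C_pow]
      ring
    rw [e2, finsetSum_coeff] at e1
    simp only [coeff_C_mul] at e1
    simp only [eval_finsetSum, eval_mul, eval_C, eval_pow, eval_X, eval_add]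
    rw [← e1]
    exact Finset.sum_congr rfl fun r _ => by ring
  have h := congrArg (fun p => p.coeff i) hpoly
  simp only [finsetSum_coeff, coeff_C_mul, coeff_X_pow] at h
  rw [← h, Finset.sum_eq_single i]
  · simp
  · intro r _ hr
    simp [hr.symm]
  · intro h
    exact absurd (Finset.mem_range.2 (Nat.lt_succ_of_le hi)) h

lemma coe_inv_S3 (x : S3) : ((x⁻¹ : S3) : ℍ[ℝ]) = star (x : ℍ[ℝ]) := by
  have hx : Quaternion.normSq (x : ℍ[ℝ]) = 1 := by
    rw [Quaternion.normSq_eq_norm_mul_self, norm_eq_of_mem_sphere x, one_mul]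
  change (x : ℍ[ℝ])⁻¹ = _
  rw [Quaternion.inv_def, hx, inv_one, one_smul]

lemma qα_inv (x : S3) : qα x⁻¹ = star (qα x) := by
  apply Complex.ext <;> simp only [qα, coe_inv_S3] <;> simp

lemma qβ_inv (x : S3) : qβ x⁻¹ = -qβ x := by
  apply Complex.ext <;> simp only [qβ, coe_inv_S3] <;> simp

/-- Unitarity of `τ_k` in the normalized monomial basis. -/
lemma star_tau (k : ℕ) (x : S3) : star (tau k x) = tau k x⁻¹ := by
  have key : ∀ i j : Fin (k + 1), (monomialWeight k j : ℂ) * star ((tauPoly k x i).coeff j)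
      = (monomialWeight k i : ℂ) * (tauPoly k x⁻¹ j).coeff i := by
    intro i j
    have hi : (i : ℕ) ≤ k := Nat.lt_succ_iff.1 i.2
    have hj : (j : ℕ) ≤ k := Nat.lt_succ_iff.1 j.2
    have hstar : star ((tauPoly k x i).coeff j)
        = ((C (star (qα x)) + C (-qβ x) * X) ^ (k - i)
          * (C (star (qβ x)) + C (qα x) * X) ^ (i : ℕ)).coeff j := by
      have h := coeff_map (starRingEnd ℂ) (p := tauPoly k x i) (j : ℕ)
      rw [tauPoly_eq] at h ⊢
      simp only [Polynomial.map_mul, Polynomial.map_pow, Polynomial.map_add, map_C, map_X] at h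
      simp only [starRingEnd_apply, star_star, star_neg] at h
      exact h.symm
    have hw : ∀ l : ℕ, l ≤ k → (k.choose l : ℂ) * (monomialWeight k l : ℂ) = k.factorial := by
      intro l hl
      have := Nat.choose_mul_factorial_mul_factorial hl
      rw [← this, monomialWeight]
      push_cast
      ring
    have h := choose_mul_coeff_linear_pow (star (qα x)) (-qβ x) (star (qβ x)) (qα x) hi hj
    rw [← hstar] at h
    have h2 : tauPoly k x⁻¹ j = (C (star (qα x)) + C (star (qβ x)) * X) ^ (k - j)
        * (C (-qβ x) + C (qα x) * X) ^ (j : ℕ) := by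
      rw [tauPoly_eq, qα_inv, qβ_inv, star_star, star_neg, neg_neg]
    rw [← h2] at h
    have hci : (k.choose i : ℂ) ≠ 0 := by exact_mod_cast (Nat.choose_pos hi).ne'
    have hcj : (k.choose j : ℂ) ≠ 0 := by exact_mod_cast (Nat.choose_pos hj).ne'
    apply mul_left_cancel₀ hci
    apply mul_left_cancel₀ hcj
    linear_combination (k.choose j * monomialWeight k j : ℂ) * h
      + (k.choose j : ℂ) * (tauPoly k x⁻¹ j).coeff i * (hw j hj - hw i hi)
  ext i j
  have hsq : ∀ l : ℕ, (Real.sqrt (monomialWeight k l) : ℂ) * Real.sqrt (monomialWeight k l)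
      = monomialWeight k l := by
    intro l
    exact_mod_cast Real.mul_self_sqrt (monomialWeight_pos k l).le
  have hi := sqrt_monomialWeight_ne_zero k i
  have hj := sqrt_monomialWeight_ne_zero k j
  have h := key i j
  rw [← hsq, ← hsq] at h
  rw [Matrix.star_apply, tau_apply, tau_apply]
  simp only [star_mul', star_div₀, Complex.star_def, Complex.conj_ofReal] at h ⊢
  field_simp
  linear_combination h

lemma tau_one (k : ℕ) : tau k 1 = 1 := by
  have h1 : qα 1 = 1 := by apply Complex.ext <;> simp [qα]
  have h2 : qβ 1 = 0 := by apply Complex.ext <;> simp [qβ]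
  ext i j
  have h : tauPoly k 1 j = X ^ (j : ℕ) := by simp [tauPoly, h1, h2]
  rw [tau_apply, h, coeff_X_pow, Matrix.one_apply]
  by_cases hij : i = j
  · have := sqrt_monomialWeight_ne_zero k j
    simp [hij, this]
  · simp [hij, Fin.val_inj]

/-- Every unit quaternion is conjugate to an element of the maximal torus `{α | β = 0}`. -/
lemma exists_conj_qβ_eq_zero (x : S3) :
    ∃ y z : S3, x * y = y * z ∧ qβ z = 0 ∧ (z : ℍ[ℝ]).re = (x : ℍ[ℝ]).re := by
  by_cases hx : (x : ℍ[ℝ]).imJ = 0 ∧ (x : ℍ[ℝ]).imK = 0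
  · exact ⟨1, x, by simp, by apply Complex.ext <;> simp [qβ, hx], rfl⟩
  set n : ℝ := Real.sqrt ((x : ℍ[ℝ]).imI ^ 2 + (x : ℍ[ℝ]).imJ ^ 2 + (x : ℍ[ℝ]).imK ^ 2) with hn
  have hn2 : n ^ 2 = (x : ℍ[ℝ]).imI ^ 2 + (x : ℍ[ℝ]).imJ ^ 2 + (x : ℍ[ℝ]).imK ^ 2 :=
    Real.sq_sqrt (by positivity)
  -- With `v` the imaginary part of `x` and `n = |v|`, one has `v (v + n i) = (v + n i) (n i)`.
  let q : ℍ[ℝ] := ⟨0, (x : ℍ[ℝ]).imI + n, (x : ℍ[ℝ]).imJ, (x : ℍ[ℝ]).imK⟩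
  let z : ℍ[ℝ] := ⟨(x : ℍ[ℝ]).re, n, 0, 0⟩
  have hq : q ≠ 0 := by
    intro h
    exact hx ⟨by simpa [q] using congrArg (fun p : ℍ[ℝ] => p.imJ) h,
      by simpa [q] using congrArg (fun p : ℍ[ℝ] => p.imK) h⟩
  have hq' : ‖q‖ ≠ 0 := norm_ne_zero_iff.2 hq
  have hmul : (x : ℍ[ℝ]) * q = q * z := by
    ext <;> simp only [Quaternion.re_mul, Quaternion.imI_mul, Quaternion.imJ_mul,
      Quaternion.imK_mul] <;> simp only [q, z] <;> linarith [hn2]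
  have hz : ‖z‖ = 1 := by
    have h := congrArg norm hmul
    rw [norm_mul, norm_mul, norm_eq_of_mem_sphere x, one_mul] at h
    exact mul_left_cancel₀ hq' (by rw [← h, mul_one])
  refine ⟨⟨‖q‖⁻¹ • q, by simp [norm_smul, hq']⟩, ⟨z, by simpa using hz⟩, ?_, ?_, rfl⟩
  · apply Subtype.ext
    change (x : ℍ[ℝ]) * (‖q‖⁻¹ • q) = (‖q‖⁻¹ • q) * z
    rw [mul_smul_comm, hmul, smul_mul_assoc]
  · apply Complex.ext <;> simp [qβ, z]

lemma sum_pow_mul_pow_eq_eval_U {a b : ℂ} {c : ℝ} (hab : a * b = 1) (hc : a + b = 2 * c) (k : ℕ) :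
    ∑ j ∈ Finset.range (k + 1), a ^ (k - j) * b ^ j
      = (((Chebyshev.U ℝ k).eval c : ℝ) : ℂ) := by
  have step : ∀ k : ℕ, ∑ j ∈ Finset.range (k + 2), a ^ (k + 1 - j) * b ^ j
      = a * (∑ j ∈ Finset.range (k + 1), a ^ (k - j) * b ^ j) + b ^ (k + 1) := by
    intro k
    rw [Finset.sum_range_succ, Nat.sub_self, pow_zero, one_mul, Finset.mul_sum]
    congr 1
    refine Finset.sum_congr rfl fun j hj => ?_
    rw [Nat.sub_add_comm (by simpa [Nat.lt_succ_iff] using hj), pow_succ']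
    ring
  induction k using Nat.twoStepInduction with
  | zero => simp
  | one => simp [Finset.sum_range_succ, hc]
  | more k ih1 ih2 =>
    have h1 := step k
    have h2 := step (k + 1)
    have hU : (Chebyshev.U ℝ ((k + 2 : ℕ) : ℤ)).eval c
        = 2 * c * (Chebyshev.U ℝ ((k + 1 : ℕ) : ℤ)).eval c - (Chebyshev.U ℝ (k : ℤ)).eval c := by
      push_cast
      rw [Chebyshev.U_add_two]
      simp
    rw [h2, hU]
    rw [ih1, ih2] at h1
    rw [ih2, Complex.ofReal_sub, Complex.ofReal_mul, Complex.ofReal_mul, Complex.ofReal_ofNat,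
      ← hc]
    linear_combination (-b) * h1 - hab * (((Chebyshev.U ℝ (k : ℤ)).eval c : ℝ) : ℂ)

/-- The character of the representation of dimension `k + 1`: Weyl's formula
`sin ((k + 1) θ) / sin θ`, where `cos θ` is the real part of `x`. -/
lemma trace_tau (k : ℕ) (x : S3) :
    (tau k x).trace = (((Chebyshev.U ℝ k).eval (x : ℍ[ℝ]).re : ℝ) : ℂ) := by
  obtain ⟨y, z, hxy, hz, hre⟩ := exists_conj_qβ_eq_zero x
  have hx : x = y * z * y⁻¹ := by rw [← hxy, mul_inv_cancel_right]
  have h1 : (tau k x).trace = (tau k z).trace := by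
    rw [hx, tau_mul, Matrix.trace_mul_comm, ← tau_mul, inv_mul_cancel_left]
  have hsq := Quaternion.normSq_eq_norm_mul_self (z : ℍ[ℝ])
  rw [norm_eq_of_mem_sphere z, one_mul, Quaternion.normSq_def'] at hsq
  have hJ : (z : ℍ[ℝ]).imJ = 0 := congrArg Complex.re hz
  have hK : (z : ℍ[ℝ]).imK = 0 := congrArg Complex.im hz
  rw [h1, ← hre, ← sum_pow_mul_pow_eq_eval_U (a := qα z) (b := star (qα z)), Matrix.trace,
    Finset.sum_range]
  · refine Finset.sum_congr rfl fun j _ => ?_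
    have h : tauPoly k z j = C (qα z ^ (k - (j : ℕ)) * star (qα z) ^ (j : ℕ)) * X ^ (j : ℕ) := by
      simp only [tauPoly, hz, star_zero, C_0, zero_mul, sub_zero, zero_add, mul_pow, C_mul, C_pow]
      ring
    have := sqrt_monomialWeight_ne_zero k j
    rw [Matrix.diag_apply, tau_apply, h, coeff_C_mul, coeff_X_pow, if_pos rfl, mul_one]
    field_simp
  · rw [Complex.star_def, Complex.mul_conj]
    norm_cast
    rw [Complex.normSq_apply]
    simp only [qα]
    nlinarith [hsq, hJ, hK]
  · apply Complex.ext <;> simp [qα]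
    ring

end Representations

lemma star_rep_mul_rep (U : Frames) (k : ℕ) (x y : S3) :
    star (rep U k x) * rep U k y
      = (U k : Matrix (Fin (k + 1)) (Fin (k + 1)) ℂ) * tau k (x⁻¹ * y)
        * star (U k : Matrix (Fin (k + 1)) (Fin (k + 1)) ℂ) := by
  have hU : star (U k : Matrix (Fin (k + 1)) (Fin (k + 1)) ℂ) * (U k : Matrix _ _ ℂ) = 1 :=
    Matrix.UnitaryGroup.star_mul_self (U k)
  simp only [rep, star_mul, star_star, tau_mul, star_tau]
  simp only [← mul_assoc]
  rw [mul_assoc _ (star (U k : Matrix (Fin (k + 1)) (Fin (k + 1)) ℂ)) (U k : Matrix _ _ ℂ), hU,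
    mul_one]

lemma star_rep_mul_self (U : Frames) (k : ℕ) (x : S3) : star (rep U k x) * rep U k x = 1 := by
  rw [star_rep_mul_rep, inv_mul_cancel, tau_one, mul_one]
  exact Matrix.mem_unitaryGroup_iff.1 (U k).2

/-- The reproducing kernel of the matrix entries of `t^ℓ` is the character, whatever the frame. -/
lemma sum_star_rep_mul_rep (U : Frames) (k : ℕ) (x y : S3) :
    ∑ m : Fin (k + 1), ∑ n : Fin (k + 1), star (rep U k x n m) * rep U k y n m
      = (((Polynomial.Chebyshev.U ℝ k).eval ((x⁻¹ * y : S3) : ℍ[ℝ]).re : ℝ) : ℂ) := by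
  have h : (star (rep U k x) * rep U k y).trace
      = ∑ m : Fin (k + 1), ∑ n : Fin (k + 1), star (rep U k x n m) * rep U k y n m := by
    simp only [Matrix.trace, Matrix.diag_apply, Matrix.mul_apply, Matrix.star_apply]
  rw [← h, star_rep_mul_rep, Matrix.trace_mul_comm, ← mul_assoc,
    Matrix.UnitaryGroup.star_mul_self (U k), one_mul, trace_tau]

end TorusSphere

namespace TorusSphere

/-! ### Haar measure and integration by parts on `S³` -/

instance isHaarMeasure_haarS3 : haarS3.IsHaarMeasure := by
  unfold haarS3; infer_instance

instance isProbabilityMeasure_haarS3 : IsProbabilityMeasure haarS3 :=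
  ⟨by simpa [haarS3] using
    Measure.haarMeasure_self (K₀ := (⊤ : TopologicalSpace.PositiveCompacts S3))⟩

/-- The compact group `S³` is unimodular. -/
instance isMulRightInvariant_haarS3 : haarS3.IsMulRightInvariant where
  map_mul_right_eq_self g := by
    have : IsProbabilityMeasure (haarS3.map (· * g)) :=
      Measure.isProbabilityMeasure_map (measurable_mul_const g).aemeasurable
    exact Measure.isHaarMeasure_eq_of_isProbabilityMeasure _ _

lemma expS3_add_smul (X : imH) (r s : ℝ) : expS3 ((r + s) • X) = expS3 (r • X) * expS3 (s • X) := by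
  apply Subtype.ext
  change NormedSpace.exp (((r + s) • X : imH) : ℍ[ℝ])
    = NormedSpace.exp ((r • X : imH) : ℍ[ℝ]) * NormedSpace.exp ((s • X : imH) : ℍ[ℝ])
  rw [add_smul, Submodule.coe_add]
  let _ : NormedAlgebra ℚ ℍ[ℝ] := NormedAlgebra.restrictScalars ℚ ℝ ℍ[ℝ]
  refine NormedSpace.exp_add_of_commute ?_
  exact (Commute.refl (X : ℍ[ℝ])).smul_left r |>.smul_right s

lemma expS3_zero : expS3 0 = 1 := by
  apply Subtype.ext
  change NormedSpace.exp ((0 : imH) : ℍ[ℝ]) = 1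
  simp

lemma hasDerivAt_flow (f : CTS) (X : imH) (t : ℝ) (x : S3) (s : ℝ) :
    HasDerivAt (fun s : ℝ => f (t, x * expS3 (s • X))) (dX X f (t, x * expS3 (s • X))) s := by
  have h := ((f.differentiable_flow X t (x * expS3 (s • X))) 0).hasDerivAt
  have h1 : HasDerivAt (fun r : ℝ => r - s) 1 s := (hasDerivAt_id s).sub_const s
  have h2 := HasDerivAt.scomp (h := fun r : ℝ => r - s) s (by rwa [sub_self]) h1
  rw [one_smul] at h2
  have e : (fun r : ℝ => f (t, x * expS3 (r • X)))
      = (fun r : ℝ => f (t, x * expS3 (s • X) * expS3 (r • X))) ∘ fun r => r - s := by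
    funext r
    simp only [Function.comp_apply, mul_assoc]
    rw [← expS3_add_smul, add_sub_cancel]
  rw [e]
  exact h2

lemma continuous_section_mul (f : CTS) (g : CS) (t : ℝ) (z : S3) :
    Continuous fun y => f (t, y * z) * g.1 y :=
  ((f.continuous_section t).comp (continuous_mul_const z)).mul (contMDiff_of_CS g).continuous

lemma CS.exists_bound (g : CS) : ∃ D, ∀ x, ‖g.1 x‖ ≤ D := by
  obtain ⟨D, hD⟩ :=
    isCompact_univ.exists_bound_of_continuousOn (contMDiff_of_CS g).continuous.continuousOn
  exact ⟨D, fun x => hD x trivial⟩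

lemma hasDerivAt_integral_flow (f : CTS) (g : CS) (X : imH) (t : ℝ) (x : S3) :
    HasDerivAt (fun s : ℝ => ∫ y, f (t, y * (x * expS3 (s • X))) * g.1 y ∂haarS3)
      (∫ y, dX X f (t, y * x) * g.1 y ∂haarS3) 0 := by
  obtain ⟨C, hC⟩ := (dX X f).exists_bound
  obtain ⟨D, hD⟩ := CS.exists_bound g
  have h := (hasDerivAt_integral_of_dominated_loc_of_deriv_le (μ := haarS3) (x₀ := (0 : ℝ))
    (F := fun (s : ℝ) y => f (t, y * (x * expS3 (s • X))) * g.1 y)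
    (F' := fun (s : ℝ) y => dX X f (t, y * (x * expS3 (s • X))) * g.1 y)
    (s := Set.univ) (bound := fun _ => C * D) Filter.univ_mem
    (Filter.Eventually.of_forall fun s => (continuous_section_mul f g t _).aestronglyMeasurable)
    ((continuous_section_mul f g t _).integrable_of_hasCompactSupport
      (HasCompactSupport.of_compactSpace _))
    (continuous_section_mul (dX X f) g t _).aestronglyMeasurable
    (Filter.Eventually.of_forall fun y s _ => ?_) (integrable_const _)
    (Filter.Eventually.of_forall fun y s _ => ?_)).2
  · simpa only [zero_smul, expS3_zero, mul_one] using h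
  · rw [norm_mul]
    exact mul_le_mul (hC _) (hD y) (norm_nonneg _) ((norm_nonneg _).trans (hC (t, y)))
  · simp only [← mul_assoc]
    exact (hasDerivAt_flow f X t (y * x) s).mul_const (g.1 y)

/-- The constant function `1` on `S³`. -/
def oneCS : CS := ⟨fun _ => 1, by exact contMDiff_const⟩

lemma integral_dX_eq_zero (f : CTS) (X : imH) (t : ℝ) : ∫ y, dX X f (t, y) ∂haarS3 = 0 := by
  have h := hasDerivAt_integral_flow f oneCS X t 1
  have hc : (fun s : ℝ => ∫ y, f (t, y * (1 * expS3 (s • X))) * oneCS.1 y ∂haarS3)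
      = fun _ => ∫ y, f (t, y) ∂haarS3 := by
    funext s
    simp only [oneCS, mul_one, one_mul]
    exact integral_mul_right_eq_self (fun y => f (t, y)) _
  rw [hc] at h
  simpa [oneCS] using h.unique (hasDerivAt_const _ _)

/-- The product of two elements of `C^∞(𝕋¹ × S³)`. -/
def mulCTS (f g : CTS) : CTS :=
  CTS.mk (fun p => f p * g p) (fun t x => by simp only [CTS.periodic])
    (contMDiff_mulC f.contMDiff g.contMDiff)

lemma integrable_section (f : CTS) (t : ℝ) : Integrable (fun x => f (t, x)) haarS3 :=
  (f.continuous_section t).integrable_of_hasCompactSupport (HasCompactSupport.of_compactSpace _)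

lemma integral_dX_mul (f g : CTS) (X : imH) (t : ℝ) :
    ∫ y, dX X f (t, y) * g (t, y) ∂haarS3 = -∫ y, f (t, y) * dX X g (t, y) ∂haarS3 := by
  have h := integral_dX_eq_zero (mulCTS f g) X t
  have hd : ∀ y, dX X (mulCTS f g) (t, y)
      = mulCTS (dX X f) g (t, y) + mulCTS f (dX X g) (t, y) := fun y => by
    have h := deriv_fun_mul (f.differentiable_flow X t y 0) (g.differentiable_flow X t y 0)
    simp only [zero_smul, expS3_zero, mul_one] at h
    exact h
  simp only [hd] at h
  rw [integral_add (integrable_section _ t) (integrable_section _ t)] at h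
  exact eq_neg_of_add_eq_zero_left h

/-- The Laplacian of `S³`, the sum of the squares of the left-invariant fields `i, j, k`, acting in
the second variable. -/
def laplaceS : CTS →ₗ[ℂ] CTS := ∑ i, dX (basisH i) ∘ₗ dX (basisH i)

lemma laplaceS_apply (f : CTS) (p : ℝ × S3) :
    laplaceS f p = ∑ i, dX (basisH i) (dX (basisH i) f) p := by
  simp [laplaceS, Fin.sum_univ_three]

lemma integral_laplaceS_mul (f g : CTS) (t : ℝ) :
    ∫ y, laplaceS f (t, y) * g (t, y) ∂haarS3 = ∫ y, f (t, y) * laplaceS g (t, y) ∂haarS3 := by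
  simp only [laplaceS_apply, Finset.sum_mul, Finset.mul_sum]
  have h1 : ∀ i : Fin 3, Integrable
      (fun y => dX (basisH i) (dX (basisH i) f) (t, y) * g (t, y)) haarS3 := fun i =>
    integrable_section (mulCTS (dX (basisH i) (dX (basisH i) f)) g) t
  have h2 : ∀ i : Fin 3, Integrable
      (fun y => f (t, y) * dX (basisH i) (dX (basisH i) g) (t, y)) haarS3 := fun i =>
    integrable_section (mulCTS f (dX (basisH i) (dX (basisH i) g))) t
  rw [integral_finsetSum _ fun i _ => h1 i, integral_finsetSum _ fun i _ => h2 i]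
  refine Finset.sum_congr rfl fun i _ => ?_
  rw [integral_dX_mul, integral_dX_mul, neg_neg]

lemma integral_laplaceS_eq_zero (f : CTS) (t : ℝ) : ∫ y, laplaceS f (t, y) ∂haarS3 = 0 := by
  simp only [laplaceS_apply]
  rw [integral_finsetSum _ fun i _ => integrable_section _ t]
  exact Finset.sum_eq_zero fun i _ => integral_dX_eq_zero _ _ t

/-! ### Characters and the Poisson kernel -/

section Characters

open Polynomial

/-- The real part of `x⁻¹ y`. It is symmetric in `x` and `y`. -/
def reInvMul (x y : S3) : ℝ := ((x⁻¹ * y : S3) : ℍ[ℝ]).re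

lemma reInvMul_comm (x y : S3) : reInvMul x y = reInvMul y x := by
  change (((x⁻¹ : S3) : ℍ[ℝ]) * (y : ℍ[ℝ])).re = (((y⁻¹ : S3) : ℍ[ℝ]) * (x : ℍ[ℝ])).re
  rw [coe_inv_S3, coe_inv_S3]
  simp only [Quaternion.re_mul, Quaternion.re_star, Quaternion.imI_star, Quaternion.imJ_star,
    Quaternion.imK_star]
  ring

lemma reInvMul_mul_right (x y z : S3) : reInvMul (x * z) (y * z) = reInvMul x y := by
  have hre : ∀ a b : ℍ[ℝ], (a * b).re = (b * a).re := fun a b => by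
    simp only [Quaternion.re_mul]
    ring
  have h : (x * z)⁻¹ * (y * z) = z⁻¹ * (x⁻¹ * y * z) := by
    rw [mul_inv_rev, mul_assoc, mul_assoc]
  have h2 : x⁻¹ * y * z * z⁻¹ = x⁻¹ * y := mul_inv_cancel_right _ _
  unfold reInvMul
  rw [h]
  exact (hre _ _).trans (congrArg (fun w : S3 => (w : ℍ[ℝ]).re) h2)

lemma contMDiff_reInvMul (x : S3) : ContMDiff (𝓡 3) 𝓘(ℝ, ℝ) ∞ (reInvMul x) := by
  let L : ℍ[ℝ] →ₗ[ℝ] ℝ :=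
    { toFun := fun q => (((x⁻¹ : S3) : ℍ[ℝ]) * q).re
      map_add' := fun p q => by simp [mul_add]
      map_smul' := fun c q => by simp }
  exact (LinearMap.toContinuousLinearMap L).contDiff.contMDiff.comp contMDiff_coe_sphere

lemma abs_re_le_one (x : S3) : |(x : ℍ[ℝ]).re| ≤ 1 := by
  have h := Quaternion.normSq_eq_norm_mul_self (x : ℍ[ℝ])
  rw [norm_eq_of_mem_sphere x, one_mul, Quaternion.normSq_def'] at h
  rw [abs_le_one_iff_mul_self_le_one]
  nlinarith [sq_nonneg (x : ℍ[ℝ]).imI, sq_nonneg (x : ℍ[ℝ]).imJ, sq_nonneg (x : ℍ[ℝ]).imK]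

lemma reInvMul_lt_one {x y : S3} (h : x ≠ y) : reInvMul x y < 1 := by
  refine lt_of_le_of_ne (abs_le.1 (abs_re_le_one _)).2 fun h1 => h ?_
  set z : S3 := x⁻¹ * y with hz
  have h1 : (z : ℍ[ℝ]).re = 1 := h1
  have hn := Quaternion.normSq_eq_norm_mul_self (z : ℍ[ℝ])
  rw [norm_eq_of_mem_sphere z, one_mul, Quaternion.normSq_def', h1] at hn
  have hI : (z : ℍ[ℝ]).imI = 0 := by
    nlinarith [sq_nonneg (z : ℍ[ℝ]).imI, sq_nonneg (z : ℍ[ℝ]).imJ, sq_nonneg (z : ℍ[ℝ]).imK]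
  have hJ : (z : ℍ[ℝ]).imJ = 0 := by
    nlinarith [sq_nonneg (z : ℍ[ℝ]).imI, sq_nonneg (z : ℍ[ℝ]).imJ, sq_nonneg (z : ℍ[ℝ]).imK]
  have hK : (z : ℍ[ℝ]).imK = 0 := by
    nlinarith [sq_nonneg (z : ℍ[ℝ]).imI, sq_nonneg (z : ℍ[ℝ]).imJ, sq_nonneg (z : ℍ[ℝ]).imK]
  have h2 : z = 1 := by
    apply Subtype.ext
    ext <;> simp [h1, hI, hJ, hK]
  exact (inv_mul_eq_one.1 h2)

/-- The zonal function `y ↦ p (Re (x⁻¹ y))`, as a function on `S³`. -/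
def zonalS (p : ℝ[X]) (x : S3) : CS :=
  ⟨fun y => ((p.eval (reInvMul x y) : ℝ) : ℂ), by
    have h : ContDiff ℝ ∞ (fun c : ℝ => ((p.eval c : ℝ) : ℂ)) :=
      Complex.ofRealCLM.contDiff.comp (by simpa using p.contDiff_aeval (𝕜 := ℝ) (n := ∞))
    exact h.contMDiff.comp (contMDiff_reInvMul x)⟩

/-- The zonal function `y ↦ p (Re (x⁻¹ y))`, as a function on `𝕋¹ × S³`. -/
def zonalTS (p : ℝ[X]) (x : S3) : CTS :=
  CTS.mk (fun q => (zonalS p x).1 q.2) (fun _ _ => rfl)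
    ((contMDiff_of_CS (zonalS p x)).comp contMDiff_snd)

lemma zonalTS_apply (p : ℝ[X]) (x : S3) (q : ℝ × S3) :
    zonalTS p x q = ((p.eval (reInvMul x q.2) : ℝ) : ℂ) := rfl

lemma hasDerivAt_re_mul_expS3 (z : ℍ[ℝ]) (X : imH) (w : ℍ[ℝ]) :
    HasDerivAt (fun s : ℝ => (z * (expS3 (s • X) : ℍ[ℝ]) * w).re) ((z * (X : ℍ[ℝ]) * w).re) 0 := by
  have h1 : HasDerivAt (fun s : ℝ => NormedSpace.exp (s • (X : ℍ[ℝ]))) (X : ℍ[ℝ]) 0 := by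
    simpa using hasDerivAt_exp_smul_const (𝕂 := ℝ) (X : ℍ[ℝ]) 0
  have h2 := (h1.const_mul z).mul_const w
  let L : ℍ[ℝ] →ₗ[ℝ] ℝ :=
    { toFun := fun q => q.re
      map_add' := fun p q => by simp
      map_smul' := fun c q => by simp }
  exact (LinearMap.toContinuousLinearMap L).hasFDerivAt.comp_hasDerivAt (0 : ℝ) h2

lemma re_mul_basisH_zero (z : ℍ[ℝ]) : (z * (basisH 0 : ℍ[ℝ])).re = -z.imI := by
  rw [Quaternion.re_mul]
  change z.re * 0 - z.imI * 1 - z.imJ * 0 - z.imK * 0 = _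
  ring

lemma re_mul_basisH_one (z : ℍ[ℝ]) : (z * (basisH 1 : ℍ[ℝ])).re = -z.imJ := by
  rw [Quaternion.re_mul]
  change z.re * 0 - z.imI * 0 - z.imJ * 1 - z.imK * 0 = _
  ring

lemma re_mul_basisH_two (z : ℍ[ℝ]) : (z * (basisH 2 : ℍ[ℝ])).re = -z.imK := by
  rw [Quaternion.re_mul]
  change z.re * 0 - z.imI * 0 - z.imJ * 0 - z.imK * 1 = _
  ring

lemma re_mul_basisH_mul_basisH (z : ℍ[ℝ]) (i : Fin 3) :
    (z * (basisH i : ℍ[ℝ]) * (basisH i : ℍ[ℝ])).re = -z.re := by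
  have h : (basisH i : ℍ[ℝ]) * (basisH i : ℍ[ℝ]) = -1 := by
    fin_cases i <;> ext <;> simp only [Quaternion.re_mul, Quaternion.imI_mul, Quaternion.imJ_mul,
      Quaternion.imK_mul] <;> simp [basisH]
  rw [mul_assoc, h, mul_neg, mul_one]
  rfl

/-- On zonal functions the Laplacian is the Gegenbauer operator `(1 - c²) ∂² - 3 c ∂`. -/
lemma laplaceS_zonalTS (p : ℝ[X]) (x : S3) :
    laplaceS (zonalTS p x)
      = zonalTS ((1 - X ^ 2) * derivative (derivative p) - 3 * X * derivative p) x := by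
  ext ⟨t, y⟩
  have hre : ∀ (V : imH) (y : S3),
      HasDerivAt (fun s : ℝ => reInvMul x (y * expS3 (s • V)))
        ((((x⁻¹ * y : S3) : ℍ[ℝ]) * (V : ℍ[ℝ])).re) 0 := fun V y => by
    have h := hasDerivAt_re_mul_expS3 ((x⁻¹ * y : S3) : ℍ[ℝ]) V 1
    simp only [mul_one] at h
    have e : (fun s : ℝ => reInvMul x (y * expS3 (s • V)))
        = fun s : ℝ => (((x⁻¹ * y : S3) : ℍ[ℝ]) * (expS3 (s • V) : ℍ[ℝ])).re := by
      funext s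
      exact congrArg (fun w : S3 => (w : ℍ[ℝ]).re) (mul_assoc x⁻¹ y (expS3 (s • V))).symm
    rw [e]
    exact h
  have h1 : ∀ (p : ℝ[X]) (V : imH) (y : S3),
      HasDerivAt (fun s : ℝ => p.eval (reInvMul x (y * expS3 (s • V))))
        ((derivative p).eval (reInvMul x y) * (((x⁻¹ * y : S3) : ℍ[ℝ]) * (V : ℍ[ℝ])).re) 0 :=
    fun p V y => by
      have hp := p.hasDerivAt (reInvMul x (y * expS3 ((0 : ℝ) • V)))
      have h := HasDerivAt.comp (h := fun s : ℝ => reInvMul x (y * expS3 (s • V))) (0 : ℝ) hp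
        (hre V y)
      simp only [zero_smul, expS3_zero, mul_one] at h
      exact h
  have hd1 : ∀ (V : imH) (q : ℝ × S3), dX V (zonalTS p x) q
      = (((derivative p).eval (reInvMul x q.2)
        * (((x⁻¹ * q.2 : S3) : ℍ[ℝ]) * (V : ℍ[ℝ])).re : ℝ) : ℂ) := fun V q => by
    exact (h1 p V q.2).ofReal_comp.deriv
  have hd2 : ∀ V : imH, dX V (dX V (zonalTS p x)) (t, y)
      = (((derivative (derivative p)).eval (reInvMul x y)
          * (((x⁻¹ * y : S3) : ℍ[ℝ]) * (V : ℍ[ℝ])).re ^ 2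
        + (derivative p).eval (reInvMul x y)
          * (((x⁻¹ * y : S3) : ℍ[ℝ]) * (V : ℍ[ℝ]) * (V : ℍ[ℝ])).re : ℝ) : ℂ) := fun V => by
    rw [dX_apply]
    simp only [hd1]
    have h := (h1 (derivative p) V y).fun_mul (hasDerivAt_re_mul_expS3 ((x⁻¹ * y : S3) : ℍ[ℝ]) V V)
    have h' : HasDerivAt (fun s : ℝ => (derivative p).eval (reInvMul x (y * expS3 (s • V)))
        * (((x⁻¹ * (y * expS3 (s • V)) : S3) : ℍ[ℝ]) * (V : ℍ[ℝ])).re)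
        ((derivative (derivative p)).eval (reInvMul x y)
          * (((x⁻¹ * y : S3) : ℍ[ℝ]) * (V : ℍ[ℝ])).re ^ 2
        + (derivative p).eval (reInvMul x y)
          * (((x⁻¹ * y : S3) : ℍ[ℝ]) * (V : ℍ[ℝ]) * (V : ℍ[ℝ])).re) 0 := by
      have e : ∀ s : ℝ, ((x⁻¹ * (y * expS3 (s • V)) : S3) : ℍ[ℝ])
          = ((x⁻¹ * y : S3) : ℍ[ℝ]) * (expS3 (s • V) : ℍ[ℝ]) := fun s =>
        congrArg Subtype.val (mul_assoc x⁻¹ y (expS3 (s • V))).symm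
      simp only [e]
      refine h.congr_deriv ?_
      have e1 : ((1 : S3) : ℍ[ℝ]) = 1 := rfl
      simp only [zero_smul, expS3_zero, e1, mul_one]
      ring
    exact h'.ofReal_comp.deriv
  have hn := Quaternion.normSq_eq_norm_mul_self ((x⁻¹ * y : S3) : ℍ[ℝ])
  rw [norm_eq_of_mem_sphere (x⁻¹ * y), one_mul, Quaternion.normSq_def'] at hn
  rw [laplaceS_apply, Fin.sum_univ_three, hd2, hd2, hd2, zonalTS_apply]
  norm_cast
  simp only [eval_sub, eval_mul, eval_one, eval_pow, eval_X, eval_ofNat]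
  unfold reInvMul
  set z := ((x⁻¹ * y : S3) : ℍ[ℝ])
  rw [re_mul_basisH_mul_basisH, re_mul_basisH_mul_basisH, re_mul_basisH_mul_basisH]
  simp only [re_mul_basisH_zero, re_mul_basisH_one, re_mul_basisH_two]
  linear_combination (derivative (derivative p)).eval z.re * hn

/-- The Chebyshev polynomial `U_k`; the character of dimension `k + 1` is `x ↦ U_k (Re x)`. -/
abbrev chebU (k : ℕ) : ℝ[X] := Chebyshev.U ℝ (k : ℤ)

lemma laplaceS_zonalTS_chebU (k : ℕ) (x : S3) :
    laplaceS (zonalTS (chebU k) x) = (-((k : ℂ) * (k + 2))) • zonalTS (chebU k) x := by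
  have h := Chebyshev.one_sub_X_sq_mul_derivative_derivative_U_eq_poly_in_U (R := ℝ) (k : ℤ)
  simp only [Function.iterate_succ, Function.iterate_zero, Function.comp_apply, id] at h
  rw [laplaceS_zonalTS, h, sub_sub_cancel_left]
  ext q
  rw [CTS.smul_apply, zonalTS_apply, zonalTS_apply]
  simp only [eval_neg, eval_mul, eval_add, eval_ofNat, eval_intCast, chebU]
  push_cast
  ring

lemma integral_zonalS_chebU (k : ℕ) (x : S3) :
    ∫ y, (zonalS (chebU k) x).1 y ∂haarS3 = if k = 0 then 1 else 0 := by
  split_ifs with hk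
  · subst hk
    simp [zonalS, chebU]
  · have h := integral_laplaceS_eq_zero (zonalTS (chebU k) x) 0
    rw [laplaceS_zonalTS_chebU] at h
    simp only [CTS.smul_apply] at h
    rw [integral_const_mul] at h
    have hk' : (k : ℂ) ≠ 0 := by exact_mod_cast hk
    have hk2 : (k : ℂ) + 2 ≠ 0 := by exact_mod_cast (by omega : k + 2 ≠ 0)
    exact (mul_eq_zero.1 h).resolve_left (neg_ne_zero.2 (mul_ne_zero hk' hk2))

lemma abs_eval_chebU_le (k : ℕ) {c : ℝ} (hc : |c| ≤ 1) : |(chebU k).eval c| ≤ k + 1 := by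
  induction k with
  | zero => simp [chebU]
  | succ k ih =>
    have h := Chebyshev.U_eq_X_mul_U_add_T ℝ (k : ℤ)
    have hT := Chebyshev.abs_eval_T_real_le_one ((k : ℤ) + 1) hc
    unfold chebU at ih ⊢
    push_cast
    rw [h, eval_add, eval_mul, eval_X]
    refine (abs_add_le _ _).trans (add_le_add ?_ hT)
    rw [abs_mul]
    exact (mul_le_mul hc ih (abs_nonneg _) zero_le_one).trans (by rw [one_mul])

lemma norm_zonalS_chebU_le (k : ℕ) (x y : S3) : ‖(zonalS (chebU k) x).1 y‖ ≤ k + 1 := by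
  change ‖(((chebU k).eval (reInvMul x y) : ℝ) : ℂ)‖ ≤ _
  rw [Complex.norm_real]
  exact abs_eval_chebU_le k (abs_re_le_one _)

lemma one_sub_two_mul_add_sq_pos {r c : ℝ} (hr0 : 0 ≤ r) (hr : r < 1) (hc : |c| ≤ 1) :
    0 < 1 - 2 * r * c + r ^ 2 := by
  have := (abs_le.1 hc).2
  nlinarith [mul_nonneg hr0 (sub_nonneg.2 this), mul_pos (sub_pos.2 hr) (sub_pos.2 hr)]

lemma summable_poisson {r : ℝ} (hr0 : 0 ≤ r) (hr : r < 1) :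
    Summable fun k : ℕ => ((k : ℝ) + 1) ^ 2 * r ^ k := by
  have h2 := summable_pow_mul_geometric_of_norm_lt_one 2 (r := r) (by rwa [Real.norm_of_nonneg hr0])
  have h1 := summable_pow_mul_geometric_of_norm_lt_one 1 (r := r) (by rwa [Real.norm_of_nonneg hr0])
  have h0 := summable_pow_mul_geometric_of_norm_lt_one 0 (r := r) (by rwa [Real.norm_of_nonneg hr0])
  refine ((h2.add (h1.mul_left 2)).add h0).congr fun k => ?_
  ring

/-- The generating function of the characters is the Poisson kernel of the unit ball of `ℝ⁴`. -/
lemma hasSum_poisson {r c : ℝ} (hr0 : 0 ≤ r) (hr : r < 1) (hc : |c| ≤ 1) :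
    HasSum (fun k : ℕ => ((k : ℝ) + 1) * r ^ k * (chebU k).eval c)
      ((1 - r ^ 2) / (1 - 2 * r * c + r ^ 2) ^ 2) := by
  set u : ℕ → ℝ := fun k => (chebU k).eval c with hu
  have hu0 : u 0 = 1 := by simp [hu, chebU]
  have hu1 : u 1 = 2 * c := by simp [hu, chebU]
  have hu2 : ∀ k, u (k + 2) = 2 * c * u (k + 1) - u k := by
    intro k
    simp only [hu, chebU]
    push_cast
    rw [Chebyshev.U_add_two]
    simp
  have hS : Summable fun k : ℕ => ((k : ℝ) + 1) * r ^ k * u k := by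
    refine Summable.of_norm_bounded (summable_poisson hr0 hr) fun k => ?_
    rw [norm_mul, Real.norm_of_nonneg (by positivity), Real.norm_eq_abs]
    calc ((k : ℝ) + 1) * r ^ k * |u k| ≤ ((k : ℝ) + 1) * r ^ k * (k + 1) := by
          gcongr
          exact abs_eval_chebU_le k hc
      _ = _ := by ring
  have hT : Summable fun k : ℕ => r ^ k * u k := by
    refine Summable.of_norm_bounded (summable_poisson hr0 hr) fun k => ?_
    rw [norm_mul, Real.norm_of_nonneg (by positivity), Real.norm_eq_abs]
    have h1 : |u k| ≤ k + 1 := abs_eval_chebU_le k hc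
    have h2 : |u k| ≤ ((k : ℝ) + 1) ^ 2 := h1.trans (by nlinarith [(k.cast_nonneg : (0 : ℝ) ≤ k)])
    rw [mul_comm]
    gcongr
  set S := ∑' k : ℕ, ((k : ℝ) + 1) * r ^ k * u k with hSdef
  set T := ∑' k : ℕ, r ^ k * u k with hTdef
  have hS1 := (summable_nat_add_iff 1).2 hS
  have hT1 := (summable_nat_add_iff 1).2 hT
  have eS1 : S = 1 + ∑' k : ℕ, (((k + 1 : ℕ) : ℝ) + 1) * r ^ (k + 1) * u (k + 1) := by
    rw [hSdef, hS.tsum_eq_zero_add, hu0]; simp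
  have eT1 : T = 1 + ∑' k : ℕ, r ^ (k + 1) * u (k + 1) := by
    rw [hTdef, hT.tsum_eq_zero_add, hu0]; simp
  have eS2 : ∑' k : ℕ, (((k + 1 : ℕ) : ℝ) + 1) * r ^ (k + 1) * u (k + 1) = 4 * r * c
      + ∑' k : ℕ, (((k + 2 : ℕ) : ℝ) + 1) * r ^ (k + 2) * u (k + 2) := by
    rw [hS1.tsum_eq_zero_add, hu1]
    push_cast
    ring_nf
  have eT2 : ∑' k : ℕ, r ^ (k + 1) * u (k + 1) = 2 * r * c
      + ∑' k : ℕ, r ^ (k + 2) * u (k + 2) := by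
    rw [hT1.tsum_eq_zero_add, hu1]
    push_cast
    ring
  have eT3 : ∑' k : ℕ, r ^ (k + 2) * u (k + 2)
      = 2 * r * c * (∑' k : ℕ, r ^ (k + 1) * u (k + 1)) - r ^ 2 * T := by
    rw [← tsum_mul_left, ← tsum_mul_left, ← (hT1.mul_left _).tsum_sub (hT.mul_left _)]
    refine tsum_congr fun k => ?_
    rw [hu2]
    ring
  have eS3 : ∑' k : ℕ, (((k + 2 : ℕ) : ℝ) + 1) * r ^ (k + 2) * u (k + 2)
      = 2 * r * c * ((∑' k : ℕ, (((k + 1 : ℕ) : ℝ) + 1) * r ^ (k + 1) * u (k + 1))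
          + ∑' k : ℕ, r ^ (k + 1) * u (k + 1)) - r ^ 2 * (S + 2 * T) := by
    rw [← hS1.tsum_add hT1, ← tsum_mul_left, ← tsum_mul_left (a := (2 : ℝ)),
      ← hS.tsum_add (hT.mul_left 2), ← tsum_mul_left,
      ← ((hS1.add hT1).mul_left _).tsum_sub ((hS.add (hT.mul_left 2)).mul_left _)]
    refine tsum_congr fun k => ?_
    rw [hu2]
    push_cast
    ring
  have hQ := one_sub_two_mul_add_sq_pos hr0 hr hc
  have hTQ : T * (1 - 2 * r * c + r ^ 2) = 1 := by
    have e : ∑' k : ℕ, r ^ (k + 1) * u (k + 1) = T - 1 := by linarith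
    rw [eT3, e] at eT2
    linarith
  have hSQ : S * (1 - 2 * r * c + r ^ 2) = T * (1 - r ^ 2) := by
    have e : ∑' k : ℕ, r ^ (k + 1) * u (k + 1) = T - 1 := by linarith
    have e' : ∑' k : ℕ, (((k + 1 : ℕ) : ℝ) + 1) * r ^ (k + 1) * u (k + 1) = S - 1 := by linarith
    rw [eS3, e, e'] at eS2
    linear_combination eS2 - hTQ
  have hval : S = (1 - r ^ 2) / (1 - 2 * r * c + r ^ 2) ^ 2 := by
    rw [eq_div_iff (by positivity)]
    linear_combination (1 - 2 * r * c + r ^ 2) * hSQ + (1 - r ^ 2) * hTQ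
  rw [← hval]
  exact hS.hasSum

end Characters

end TorusSphere

namespace TorusSphere

/-! ### The isotypic projections and the convergence of Fourier series in `C^∞(𝕋¹ × S³)` -/

section Projections

open Filter Topology

lemma CTS.sum_apply {ι : Type*} (s : Finset ι) (f : ι → CTS) (p : ℝ × S3) :
    (∑ i ∈ s, f i) p = ∑ i ∈ s, f i p := by
  classical
  induction s using Finset.induction_on with
  | empty => simp only [Finset.sum_empty]; rfl
  | insert i s hi ih => rw [Finset.sum_insert hi, Finset.sum_insert hi, CTS.add_apply, ih]

/-- The term of index `ℓ = k / 2` of the partial Fourier series of `f`, that is, the projection of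
`f` to its isotypic component of dimension `k + 1`. -/
def isoProj (U : Frames) (k : ℕ) (f : CTS) : CTS :=
  ((k : ℂ) + 1) • ∑ m : Fin (k + 1), ∑ n : Fin (k + 1), tensor (repS U k n m) (coeff U f k m n)

lemma integrable_section_mul (f : CTS) (g : CS) (t : ℝ) :
    Integrable (fun y => f (t, y) * g.1 y) haarS3 := by
  have h := continuous_section_mul f g t 1
  simp only [mul_one] at h
  exact h.integrable_of_hasCompactSupport (HasCompactSupport.of_compactSpace _)

lemma sum_integral_mul_mul {ι κ : Type*} [Fintype ι] [Fintype κ] (f : CTS) (t : ℝ)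
    {g : ι → κ → CS} {c : ι → κ → ℂ} {K : CS}
    (hK : ∀ y, ∑ i, ∑ j, (g i j).1 y * c i j = K.1 y) :
    ∑ i, ∑ j, (∫ y, f (t, y) * (g i j).1 y ∂haarS3) * c i j = ∫ y, f (t, y) * K.1 y ∂haarS3 := by
  have hint : ∀ i j, Integrable (fun y => f (t, y) * (g i j).1 y * c i j) haarS3 := fun i j =>
    (integrable_section_mul f (g i j) t).mul_const _
  simp only [← integral_mul_const]
  simp only [← integral_finsetSum _ fun j _ => hint _ j]
  rw [← integral_finsetSum _ fun i _ => integrable_finsetSum _ fun j _ => hint i j]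
  refine integral_congr_ae (Eventually.of_forall fun y => ?_)
  simp only [← hK, Finset.mul_sum, mul_assoc]

lemma sum_star_rep_mul_rep_eq_zonalS (U : Frames) (k : ℕ) (x y : S3) :
    ∑ m : Fin (k + 1), ∑ n : Fin (k + 1), star (rep U k y n m) * rep U k x n m
      = (zonalS (chebU k) x).1 y := by
  rw [sum_star_rep_mul_rep]
  change _ = (((chebU k).eval (reInvMul x y) : ℝ) : ℂ)
  rw [reInvMul_comm]
  rfl

lemma sum_rep_mul_star_rep_eq_zonalS (U : Frames) (k : ℕ) (x y : S3) :
    ∑ m : Fin (k + 1), ∑ n : Fin (k + 1), rep U k y n m * star (rep U k x n m)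
      = (zonalS (chebU k) x).1 y := by
  simp only [mul_comm (rep U k y _ _)]
  exact sum_star_rep_mul_rep U k x y

lemma isoProj_apply_eq_sum (U : Frames) (k : ℕ) (f : CTS) (t : ℝ) (x : S3) :
    isoProj U k f (t, x) = ((k : ℂ) + 1) * ∑ m : Fin (k + 1), ∑ n : Fin (k + 1),
      (coeff U f k m n).1 t * rep U k x n m := by
  rw [isoProj, CTS.smul_apply, CTS.sum_apply]
  simp only [CTS.sum_apply]
  rfl

/-- The isotypic projections are convolutions with the characters. -/
lemma isoProj_apply (U : Frames) (k : ℕ) (f : CTS) (t : ℝ) (x : S3) :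
    isoProj U k f (t, x)
      = ((k : ℂ) + 1) * ∫ y, f (t, y) * (zonalS (chebU k) x).1 y ∂haarS3 := by
  rw [isoProj_apply_eq_sum,
    ← sum_integral_mul_mul (g := fun m n => repConjS U k n m) (c := fun m n => rep U k x n m) f t
      fun y => sum_star_rep_mul_rep_eq_zonalS U k x y]
  rfl

lemma isoProj_apply_translate (U : Frames) (k : ℕ) (f : CTS) (t : ℝ) (x : S3) :
    isoProj U k f (t, x)
      = ((k : ℂ) + 1) * ∫ y, f (t, y * x) * (zonalS (chebU k) 1).1 y ∂haarS3 := by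
  rw [isoProj_apply, ← integral_mul_right_eq_self _ x]
  congr 2
  funext y
  have h := reInvMul_mul_right 1 y x
  rw [one_mul] at h
  simp only [zonalS, h]

lemma dt_isoProj (U : Frames) (k : ℕ) (f : CTS) : dt (isoProj U k f) = isoProj U k (dt f) := by
  ext ⟨t, x⟩
  rw [dt_apply, isoProj_apply]
  simp only [isoProj_apply]
  exact ((hasDerivAt_integral_section f (zonalS (chebU k) x) t).const_mul _).deriv

lemma dX_isoProj (U : Frames) (k : ℕ) (X : imH) (f : CTS) :
    dX X (isoProj U k f) = isoProj U k (dX X f) := by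
  ext ⟨t, x⟩
  rw [dX_apply, isoProj_apply_translate]
  simp only [isoProj_apply_translate]
  exact ((hasDerivAt_integral_flow f (zonalS (chebU k) 1) X t x).const_mul _).deriv

lemma wordD_isoProj (U : Frames) (k : ℕ) (w : List (Option (Fin 3))) (f : CTS) :
    wordD w (isoProj U k f) = isoProj U k (wordD w f) := by
  induction w generalizing f with
  | nil => rfl
  | cons d w ih =>
    have h : frame d (isoProj U k f) = isoProj U k (frame d f) := by
      cases d with
      | none => exact dt_isoProj U k f
      | some i => exact dX_isoProj U k (basisH i) f
    change wordD w (frame d (isoProj U k f)) = isoProj U k (wordD w (frame d f))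
    rw [h, ih]

lemma norm_apply_le_norm_toBCF (f : CTS) (p : ℝ × S3) : ‖f p‖ ≤ ‖toBCF f‖ :=
  (toBCF f).norm_coe_le_norm p

lemma norm_natCast_add_one (k : ℕ) : ‖(k : ℂ) + 1‖ = (k : ℝ) + 1 := by
  have := Complex.norm_natCast (k + 1)
  push_cast at this
  exact this

lemma norm_toBCF_isoProj_le (U : Frames) (k : ℕ) (f : CTS) :
    ‖toBCF (isoProj U k f)‖ ≤ ((k : ℝ) + 1) ^ 2 * ‖toBCF f‖ := by
  refine (BoundedContinuousFunction.norm_le (by positivity)).2 fun p => ?_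
  obtain ⟨t, x⟩ := p
  change ‖isoProj U k f (t, x)‖ ≤ _
  have h : ‖∫ y, f (t, y) * (zonalS (chebU k) x).1 y ∂haarS3‖
      ≤ ‖toBCF f‖ * ((k : ℝ) + 1) * haarS3.real Set.univ :=
    norm_integral_le_of_norm_le_const (Eventually.of_forall fun y => by
      rw [norm_mul]
      exact mul_le_mul (norm_apply_le_norm_toBCF f _) (norm_zonalS_chebU_le k x y)
        (norm_nonneg _) (norm_nonneg _))
  rw [probReal_univ, mul_one] at h
  rw [isoProj_apply, norm_mul, norm_natCast_add_one]
  calc ((k : ℝ) + 1) * _ ≤ ((k : ℝ) + 1) * (‖toBCF f‖ * ((k : ℝ) + 1)) := by gcongr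
    _ = _ := by ring

/-- On the isotypic component of dimension `k + 1`, the operator `1 - Δ` is `(k + 1) ^ 2`. -/
lemma isoProj_sub_laplaceS (U : Frames) (k : ℕ) (f : CTS) :
    isoProj U k (f - laplaceS f) = (((k : ℂ) + 1) ^ 2) • isoProj U k f := by
  ext ⟨t, x⟩
  rw [CTS.smul_apply, isoProj_apply, isoProj_apply]
  have h := integral_laplaceS_mul f (zonalTS (chebU k) x) t
  rw [laplaceS_zonalTS_chebU] at h
  simp only [CTS.smul_apply, mul_left_comm _ (-((k : ℂ) * (k + 2)))] at h
  rw [integral_const_mul] at h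
  have hsub : ∀ y, (f - laplaceS f) (t, y) * (zonalS (chebU k) x).1 y
      = f (t, y) * (zonalS (chebU k) x).1 y - laplaceS f (t, y) * (zonalS (chebU k) x).1 y :=
    fun y => sub_mul _ _ _
  have h' : ∫ y, laplaceS f (t, y) * (zonalS (chebU k) x).1 y ∂haarS3
      = -((k : ℂ) * (k + 2)) * ∫ y, f (t, y) * (zonalS (chebU k) x).1 y ∂haarS3 := h
  simp only [hsub]
  rw [integral_sub (integrable_section_mul f _ t) (integrable_section_mul _ _ t), h']
  ring

/-- The Fourier series of a smooth function is normally convergent. -/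
lemma summable_norm_isoProj (U : Frames) (f : CTS) :
    Summable fun k => ‖toBCF (isoProj U k f)‖ := by
  set g : CTS := (f - laplaceS f) - laplaceS (f - laplaceS f) with hg
  have hb : ∀ k : ℕ, ‖toBCF (isoProj U k f)‖ ≤ ‖toBCF g‖ * (((k + 1 : ℕ) : ℝ) ^ 2)⁻¹ := by
    intro k
    have h1 : isoProj U k g = (((k : ℂ) + 1) ^ 2 * ((k : ℂ) + 1) ^ 2) • isoProj U k f := by
      rw [hg, isoProj_sub_laplaceS, isoProj_sub_laplaceS, smul_smul]
    have h2 := norm_toBCF_isoProj_le U k g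
    rw [h1, map_smul, norm_smul, norm_mul, norm_pow, norm_natCast_add_one, mul_assoc] at h2
    have h3 := le_of_mul_le_mul_left h2 (by positivity)
    push_cast
    rw [← div_eq_mul_inv, le_div_iff₀ (by positivity), mul_comm]
    exact h3
  refine Summable.of_nonneg_of_le (fun k => norm_nonneg _) hb (Summable.mul_left _ ?_)
  exact (summable_nat_add_iff 1).2 (Real.summable_nat_pow_inv.2 one_lt_two)

/-- The Poisson kernel with radius `r` and pole `x`. -/
def poissonKernelS (x : S3) (r : ℝ) (y : S3) : ℝ :=
  (1 - r ^ 2) / (1 - 2 * r * reInvMul x y + r ^ 2) ^ 2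

lemma hasSum_integral_poisson (U : Frames) (f : CTS) (t : ℝ) (x : S3) {r : ℝ} (hr0 : 0 ≤ r)
    (hr : r < 1) :
    HasSum (fun k : ℕ => isoProj U k f (t, x) * (r : ℂ) ^ k)
      (∫ y, poissonKernelS x r y • f (t, y) ∂haarS3) := by
  let F : ℕ → S3 → ℂ := fun k y =>
    ((k : ℂ) + 1) * (r : ℂ) ^ k * (f (t, y) * (zonalS (chebU k) x).1 y)
  have hFi : ∀ k, Integrable (F k) haarS3 := fun k =>
    (integrable_section_mul f _ t).const_mul _
  have hFn : ∀ k y, ‖F k y‖ ≤ ‖toBCF f‖ * (((k : ℝ) + 1) ^ 2 * r ^ k) := by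
    intro k y
    simp only [F]
    rw [norm_mul, norm_mul, norm_mul, norm_natCast_add_one, norm_pow,
      Complex.norm_real, Real.norm_of_nonneg hr0]
    calc ((k : ℝ) + 1) * r ^ k * (‖f (t, y)‖ * ‖(zonalS (chebU k) x).1 y‖)
        ≤ ((k : ℝ) + 1) * r ^ k * (‖toBCF f‖ * ((k : ℝ) + 1)) := by
          gcongr
          · exact norm_apply_le_norm_toBCF f _
          · exact norm_zonalS_chebU_le k x y
      _ = _ := by ring
  have hs : Summable fun k : ℕ => ‖toBCF f‖ * (((k : ℝ) + 1) ^ 2 * r ^ k) :=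
    (summable_poisson hr0 hr).mul_left _
  have hsum : Summable fun k => ∫ y, ‖F k y‖ ∂haarS3 := by
    refine Summable.of_nonneg_of_le (fun k => integral_nonneg fun y => norm_nonneg _)
      (fun k => ?_) hs
    refine (integral_mono (hFi k).norm (integrable_const _) (hFn k)).trans (le_of_eq ?_)
    simp
  have h := hasSum_integral_of_summable_integral_norm hFi hsum
  have e1 : (fun k => ∫ y, F k y ∂haarS3) = fun k => isoProj U k f (t, x) * (r : ℂ) ^ k := by
    funext k
    simp only [F]
    rw [integral_const_mul, isoProj_apply]
    ring
  have e2 : (fun y => ∑' k, F k y) = fun y => poissonKernelS x r y • f (t, y) := by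
    funext y
    have h1 := (hasSum_poisson hr0 hr (abs_re_le_one (x⁻¹ * y))).mapL Complex.ofRealCLM
    have h2 := (h1.mul_right (f (t, y))).tsum_eq
    rw [Complex.real_smul]
    refine Eq.trans (tsum_congr fun k => ?_) h2
    simp only [F, zonalS, reInvMul, Complex.ofRealCLM_apply]
    push_cast
    ring
  rw [e1, e2] at h
  exact h

/-- The function `1` on `𝕋¹ × S³`. -/
def oneCTS : CTS := CTS.mk (fun _ => 1) (fun _ _ => rfl) contMDiff_const

lemma integral_poissonKernelS (x : S3) {r : ℝ} (hr0 : 0 ≤ r) (hr : r < 1) :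
    ∫ y, poissonKernelS x r y ∂haarS3 = 1 := by
  have h := hasSum_integral_poisson (fun _ => 1) oneCTS 0 x hr0 hr
  have h1 : ∀ k : ℕ,
      isoProj (fun _ => 1) k oneCTS (0, x) * (r : ℂ) ^ k = if k = 0 then 1 else 0 := by
    intro k
    have : ∀ y, oneCTS (0, y) * (zonalS (chebU k) x).1 y = (zonalS (chebU k) x).1 y := fun y =>
      one_mul _
    rw [isoProj_apply]
    simp only [this]
    rw [integral_zonalS_chebU]
    split_ifs with hk
    · simp [hk]
    · simp
  have h2 : ∀ y, poissonKernelS x r y • oneCTS (0, y) = ((poissonKernelS x r y : ℝ) : ℂ) :=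
    fun y => by
      rw [Complex.real_smul]
      exact mul_one _
  simp only [h1, h2] at h
  have h3 := h.unique (hasSum_ite_eq 0 1)
  rw [integral_complex_ofReal] at h3
  exact_mod_cast h3

lemma continuous_poissonKernelS (x : S3) {r : ℝ} (hr0 : 0 ≤ r) (hr : r < 1) :
    Continuous (poissonKernelS x r) := by
  have hc : Continuous (reInvMul x) := (contMDiff_reInvMul x).continuous
  refine Continuous.div continuous_const (by fun_prop) fun y => ?_
  exact (pow_pos (one_sub_two_mul_add_sq_pos hr0 hr (abs_re_le_one _)) 2).ne'

/-- The Poisson kernels are an approximate identity as the radius tends to `1`. -/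
lemma tendsto_integral_poissonKernelS (f : CTS) (t : ℝ) (x : S3) :
    Tendsto (fun r : ℝ => ∫ y, poissonKernelS x r y • f (t, y) ∂haarS3) (𝓝[<] 1)
      (𝓝 (f (t, x))) := by
  have hev : ∀ᶠ r : ℝ in 𝓝[<] 1, 1 / 2 < r ∧ r < 1 := by
    filter_upwards [Ioo_mem_nhdsLT (by norm_num : (1 / 2 : ℝ) < 1)] with r hr using hr
  refine tendsto_integral_peak_smul_of_integrable_of_tendsto (t := Set.univ) (x₀ := x)
    MeasurableSet.univ univ_mem (measure_ne_top _ _) ?_ ?_ ?_ ?_ (integrable_section f t)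
    ((f.continuous_section t).tendsto x)
  · filter_upwards [hev] with r hr y
    have : r ^ 2 ≤ 1 := by nlinarith [hr.1, hr.2]
    exact div_nonneg (by linarith) (by positivity)
  · intro u hu hxu
    -- Away from the pole, `Re (x⁻¹ y)` is bounded by some `c < 1`, by compactness.
    obtain ⟨c, hc1, hc⟩ : ∃ c : ℝ, c < 1 ∧ ∀ y ∈ uᶜ, reInvMul x y ≤ c := by
      rcases (uᶜ).eq_empty_or_nonempty with he | hne
      · exact ⟨0, zero_lt_one, fun y hy => by simp [he] at hy⟩
      · obtain ⟨z, hz, hmax⟩ := hu.isClosed_compl.isCompact.exists_isMaxOn hne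
          (contMDiff_reInvMul x).continuous.continuousOn
        exact ⟨_, reInvMul_lt_one (fun h : x = z => hz (h ▸ hxu)), fun y hy => hmax hy⟩
    rw [Metric.tendstoUniformlyOn_iff]
    intro ε hε
    have hlim : Tendsto (fun r : ℝ => (1 - r ^ 2) / (1 - c) ^ 2) (𝓝[<] 1) (𝓝 0) := by
      have hcont : Continuous fun r : ℝ => (1 - r ^ 2) / (1 - c) ^ 2 := by fun_prop
      have := (hcont.tendsto 1).mono_left (nhdsWithin_le_nhds (s := Set.Iio 1))
      simpa using this
    filter_upwards [hev, (tendsto_order.1 hlim).2 ε hε] with r hr hlt y hy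
    have hr2 : r ^ 2 ≤ 1 := by nlinarith [hr.1, hr.2]
    have hQ : 1 - c ≤ 1 - 2 * r * reInvMul x y + r ^ 2 := by
      have := hc y hy
      have h1 := (abs_le.1 (abs_re_le_one (x⁻¹ * y))).2
      change reInvMul x y ≤ 1 at h1
      nlinarith [sq_nonneg (1 - r), mul_nonneg (by linarith [hr.1] : 0 ≤ 2 * r - 1)
        (sub_nonneg.2 h1)]
    have hc0 : 0 < 1 - c := sub_pos.2 hc1
    have hnn : 0 ≤ poissonKernelS x r y := div_nonneg (by linarith) (by positivity)
    rw [Pi.zero_apply, dist_zero_left, Real.norm_of_nonneg hnn]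
    refine lt_of_le_of_lt ?_ hlt
    exact div_le_div_of_nonneg_left (by linarith) (by positivity)
      (pow_le_pow_left₀ hc0.le hQ 2)
  · refine tendsto_const_nhds.congr' ?_
    filter_upwards [hev] with r hr
    rw [setIntegral_univ, integral_poissonKernelS x (by linarith [hr.1]) hr.2]
  · filter_upwards [hev] with r hr
    exact (continuous_poissonKernelS x (by linarith [hr.1]) hr.2).aestronglyMeasurable

/-- The Fourier series of a smooth function converges to it: the sum is identified by Abel
summation. -/
lemma hasSum_isoProj_apply (U : Frames) (f : CTS) (p : ℝ × S3) :
    HasSum (fun k => isoProj U k f p) (f p) := by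
  obtain ⟨t, x⟩ := p
  have hs : Summable fun k => isoProj U k f (t, x) :=
    Summable.of_norm_bounded (summable_norm_isoProj U f) fun k => norm_apply_le_norm_toBCF _ _
  have h1 := Complex.tendsto_tsum_powerSeries_nhdsWithin_lt hs.hasSum.tendsto_sum_nat
  rw [tendsto_map'_iff] at h1
  have h2 : Tendsto ((fun z : ℂ => ∑' n, isoProj U n f (t, x) * z ^ n) ∘ Complex.ofReal) (𝓝[<] 1)
      (𝓝 (f (t, x))) := by
    refine (tendsto_integral_poissonKernelS f t x).congr' ?_
    filter_upwards [Ioo_mem_nhdsLT (zero_lt_one' ℝ)] with r hr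
    exact (hasSum_integral_poisson U f t x hr.1.le hr.2).tsum_eq.symm
  rw [← tendsto_nhds_unique h1 h2]
  exact hs.hasSum

lemma hasSum_toBCF_isoProj (U : Frames) (f : CTS) :
    HasSum (fun k => toBCF (isoProj U k f)) (toBCF f) := by
  have hs : Summable fun k => toBCF (isoProj U k f) := (summable_norm_isoProj U f).of_norm
  have h : ∑' k, toBCF (isoProj U k f) = toBCF f := by
    ext p
    have h1 := hs.hasSum.mapL (BoundedContinuousFunction.evalCLM ℂ p)
    exact h1.unique (hasSum_isoProj_apply U f p)
  rw [← h]
  exact hs.hasSum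

/-- The Fourier series of a smooth function converges to it in the topology of
`C^∞(𝕋¹ × S³)`. -/
lemma hasSum_isoProj (U : Frames) (f : CTS) : HasSum (fun k => isoProj U k f) f := by
  refine (withSeminormsTS.tendsto_nhds _ _).2 fun w ε hε => ?_
  have h := tendsto_iff_norm_sub_tendsto_zero.1 (hasSum_toBCF_isoProj U (wordD w f))
  filter_upwards [(tendsto_order.1 h).2 ε hε] with s hs
  change ‖toBCF (wordD w (∑ k ∈ s, isoProj U k f - f))‖ < ε
  simpa only [map_sub, map_sum, wordD_isoProj] using hs

end Projections

end TorusSphere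

namespace TorusSphere

/-! ### Right translation by `exp (B(t) X)` -/

/-- The pull-back `f ↦ ((t, x) ↦ f (t, x exp (B(t) X)))`. -/
def pull (B : RT) (X : imH) : CTS →ₗ[ℂ] CTS where
  toFun f := CTS.mk (fun p => f (p.1, p.2 * expS3 (B.1 p.1 • X)))
    (fun t x => by simp only [f.periodic, B.2.1 t])
    (by
      have hB : ContDiff ℝ ∞ (fun t : ℝ => B.1 t • X) := B.2.2.smul contDiff_const
      exact f.contMDiff.comp (contMDiff_fst.prodMk (contMDiff_mulS3.comp
        (contMDiff_snd.prodMk ((contMDiff_expS3.comp hB.contMDiff).comp contMDiff_fst)))))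
  map_add' _ _ := rfl
  map_smul' _ _ := rfl

lemma pull_apply (B : RT) (X : imH) (f : CTS) (t : ℝ) (x : S3) :
    pull B X f (t, x) = f (t, x * expS3 (B.1 t • X)) := rfl

lemma pull_pull_of_add_eq_zero {B C : RT} (h : ∀ t, B.1 t + C.1 t = 0) (X : imH) (f : CTS) :
    pull B X (pull C X f) = f := by
  ext ⟨t, x⟩
  rw [pull_apply, pull_apply, mul_assoc, ← expS3_add_smul, h, zero_smul, expS3_zero, mul_one]

lemma dX_pull_self (B : RT) (X : imH) (f : CTS) : dX X (pull B X f) = pull B X (dX X f) := by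
  ext ⟨t, x⟩
  rw [pull_apply, dX_apply, dX_apply]
  congr 1
  funext s
  rw [pull_apply, mul_assoc, mul_assoc, ← expS3_add_smul, ← expS3_add_smul, add_comm]

/-- The derivative of a real-valued smooth function on `𝕋¹`, viewed as complex-valued. -/
def derivRT (B : RT) : CT := derivT (RT.toComplex B)

lemma derivRT_apply (B : RT) (t : ℝ) : (derivRT B).1 t = ((deriv B.1 t : ℝ) : ℂ) :=
  ((B.2.2.differentiable (by simp)) t).hasDerivAt.ofReal_comp.deriv

lemma dt_pull (B : RT) (X : imH) (f : CTS) :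
    dt (pull B X f) = pull B X (dt f) + mulT (derivRT B) (pull B X (dX X f)) := by
  ext ⟨t, x⟩
  -- Chain rule for `G(t, B(t))`, where `G(t, s) = f(t, x exp(sX))`.
  let G : ℝ × ℝ → ℂ := fun q => f (q.1, x * expS3 (q.2 • X))
  have hG : ContDiff ℝ ∞ G := by
    have h : ContMDiff 𝓘(ℝ, ℝ × ℝ) ((𝓘(ℝ, ℝ).prod (𝓡 3)).prod 𝓘(ℝ, ℝ)) ∞
        (fun q : ℝ × ℝ => (((q.1, x) : ℝ × S3), q.2)) :=
      (contDiff_fst.contMDiff.prodMk contMDiff_const).prodMk contDiff_snd.contMDiff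
    exact ((f.contMDiff_flow X).comp h).contDiff
  have hG' := ((hG.differentiable (by simp)) (t, B.1 t)).hasFDerivAt
  have h1 : fderiv ℝ G (t, B.1 t) (1, 0) = dt f (t, x * expS3 (B.1 t • X)) := by
    have hl : HasDerivAt (fun s : ℝ => (s, B.1 t)) ((1 : ℝ), (0 : ℝ)) t :=
      (hasDerivAt_id t).prodMk (hasDerivAt_const t _)
    exact (hG'.comp_hasDerivAt t hl).deriv.symm
  have h2 : fderiv ℝ G (t, B.1 t) (0, 1) = dX X f (t, x * expS3 (B.1 t • X)) := by
    have hl : HasDerivAt (fun s : ℝ => (t, s)) ((0 : ℝ), (1 : ℝ)) (B.1 t) :=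
      (hasDerivAt_const _ t).prodMk (hasDerivAt_id _)
    exact (hG'.comp_hasDerivAt (B.1 t) hl).unique (hasDerivAt_flow f X t x (B.1 t))
  have hB : HasDerivAt (fun s : ℝ => (s, B.1 s)) ((1 : ℝ), deriv B.1 t) t :=
    (hasDerivAt_id t).prodMk ((B.2.2.differentiable (by simp)) t).hasDerivAt
  have h3 := (hG'.comp_hasDerivAt t hB).deriv
  have hv : ((1 : ℝ), deriv B.1 t) = (1, 0) + deriv B.1 t • ((0 : ℝ), (1 : ℝ)) := by simp
  rw [hv, map_add, map_smul, h1, h2, Complex.real_smul, ← derivRT_apply] at h3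
  exact h3

/-- A translation by `exp (B(t) X)` intertwines the operators `∂_t + a(t) X` and
`∂_t + (a(t) + B'(t)) X`. -/
lemma opL_pull {a b B : RT} (h : ∀ t, deriv B.1 t + a.1 t = b.1 t) (X : imH) (f : CTS) :
    opL a X (pull B X f) = pull B X (opL b X f) := by
  rw [opL, opL, dt_pull, dX_pull_self]
  ext ⟨t, x⟩
  simp only [map_add, CTS.add_apply, mulT_apply, pull_apply, derivRT_apply]
  simp only [RT.toComplex, ← h, Complex.ofReal_add]
  ring

/-- The adjoint action `Y ↦ g⁻¹ Y g` on the Lie algebra. -/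
def adInv (g : S3) (Y : imH) : imH :=
  ⟨star (g : ℍ[ℝ]) * (Y : ℍ[ℝ]) * (g : ℍ[ℝ]), by
    have h : (Y : ℍ[ℝ]).re = 0 := Y.2
    change (star (g : ℍ[ℝ]) * (Y : ℍ[ℝ]) * (g : ℍ[ℝ])).re = 0
    simp only [Quaternion.re_mul, Quaternion.imI_mul, Quaternion.imJ_mul, Quaternion.imK_mul,
      Quaternion.re_star, Quaternion.imI_star, Quaternion.imJ_star, Quaternion.imK_star, h]
    ring⟩

lemma expS3_smul_mul (g : S3) (Y : imH) (s : ℝ) :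
    expS3 (s • Y) * g = g * expS3 (s • adInv g Y) := by
  have hg : (g : ℍ[ℝ]) ≠ 0 := ne_zero_of_mem_unit_sphere g
  have hinv : star (g : ℍ[ℝ]) = (g : ℍ[ℝ])⁻¹ := (coe_inv_S3 g).symm
  have hconj : ((s • adInv g Y : imH) : ℍ[ℝ])
      = (g : ℍ[ℝ])⁻¹ * ((s • Y : imH) : ℍ[ℝ]) * (g : ℍ[ℝ]) := by
    rw [← hinv]
    change s • (star (g : ℍ[ℝ]) * (Y : ℍ[ℝ]) * (g : ℍ[ℝ]))
      = star (g : ℍ[ℝ]) * (s • (Y : ℍ[ℝ])) * _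
    rw [mul_smul_comm, smul_mul_assoc]
  let _ : NormedAlgebra ℚ ℍ[ℝ] := NormedAlgebra.restrictScalars ℚ ℝ ℍ[ℝ]
  apply Subtype.ext
  change NormedSpace.exp ((s • Y : imH) : ℍ[ℝ]) * (g : ℍ[ℝ])
    = (g : ℍ[ℝ]) * NormedSpace.exp ((s • adInv g Y : imH) : ℍ[ℝ])
  rw [hconj, NormedSpace.exp_conj' _ _ hg, ← mul_assoc, ← mul_assoc, mul_inv_cancel₀ hg, one_mul]

/-- The coordinate `L` of `Ad (exp (B(t) X))⁻¹ Y`, as a function on `𝕋¹`. -/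
def adCoeff (B : RT) (X Y : imH) (L : ℍ[ℝ] →ₗ[ℝ] ℝ) : CT :=
  ⟨fun t => (L (adInv (expS3 (B.1 t • X)) Y : ℍ[ℝ]) : ℂ), fun t => by simp only [B.2.1 t], by
    have he : ContDiff ℝ ∞ (NormedSpace.exp : ℍ[ℝ] → ℍ[ℝ]) :=
      contDiff_iff_contDiffAt.2 fun x => (NormedSpace.exp_analytic (𝕂 := ℝ) x).contDiffAt
    have h1 : ContDiff ℝ ∞ fun t : ℝ => NormedSpace.exp (B.1 t • (X : ℍ[ℝ])) :=
      he.comp (B.2.2.smul contDiff_const)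
    have h2 : ContDiff ℝ ∞ fun t : ℝ => star (NormedSpace.exp (B.1 t • (X : ℍ[ℝ]))) :=
      (LinearMap.toContinuousLinearMap
        ({ toFun := star
           map_add' := star_add
           map_smul' := fun c q => Quaternion.star_smul c q } : ℍ[ℝ] →ₗ[ℝ] ℍ[ℝ])).contDiff.comp h1
    exact Complex.ofRealCLM.contDiff.comp
      ((LinearMap.toContinuousLinearMap L).contDiff.comp ((h2.mul contDiff_const).mul h1))⟩

/-- The coordinates of a quaternion along `i, j, k`. -/
def imCoord : Fin 3 → ℍ[ℝ] →ₗ[ℝ] ℝ :=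
  ![{ toFun := fun q => q.imI, map_add' := fun _ _ => by simp, map_smul' := fun _ _ => by simp },
    { toFun := fun q => q.imJ, map_add' := fun _ _ => by simp, map_smul' := fun _ _ => by simp },
    { toFun := fun q => q.imK, map_add' := fun _ _ => by simp, map_smul' := fun _ _ => by simp }]

lemma dX_pull (B : RT) (X Y : imH) (f : CTS) :
    dX Y (pull B X f)
      = ∑ i, mulT (adCoeff B X Y (imCoord i)) (pull B X (frame (some i) f)) := by
  ext ⟨t, x⟩
  have h : dX Y (pull B X f) (t, x)
      = dX (adInv (expS3 (B.1 t • X)) Y) f (t, x * expS3 (B.1 t • X)) := by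
    rw [dX_apply, dX_apply]
    congr 1
    funext s
    rw [pull_apply, mul_assoc, mul_assoc, expS3_smul_mul]
  rw [h, dX_eq_sum, CTS.sum_apply, Fin.sum_univ_three]
  rfl

lemma mulT_mulT (g h : CT) (f : CTS) : mulT g (mulT h f) = mulT (mulCT g h) f := by
  ext p
  exact (mul_assoc _ _ _).symm

lemma CT.exists_bound (g : CT) : ∃ C, ∀ p : ℝ × S3, ‖g.1 p.1‖ ≤ C := by
  obtain ⟨C, hC⟩ := (mulT g oneCTS).exists_bound
  exact ⟨C, fun p => by simpa [oneCTS] using hC p⟩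

lemma continuous_toBCF_wordD_mulT_pull (B : RT) (X : imH) (w : List (Option (Fin 3))) (g : CT) :
    Continuous fun f => toBCF (wordD w (mulT g (pull B X f))) := by
  induction w generalizing g with
  | nil =>
    obtain ⟨C, hC⟩ := CT.exists_bound g
    have hgc : Continuous fun p : ℝ × S3 => g.1 p.1 := g.2.2.continuous.comp continuous_fst
    let G : BoundedContinuousFunction (ℝ × S3) ℂ :=
      BoundedContinuousFunction.ofNormedAddCommGroup _ hgc C hC
    have hφ : Continuous fun p : ℝ × S3 => (p.1, p.2 * expS3 (B.1 p.1 • X)) :=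
      continuous_fst.prodMk (continuous_snd.mul (contMDiff_expS3.continuous.comp
        ((B.2.2.continuous.comp continuous_fst).smul continuous_const)))
    have h : (fun f => toBCF (wordD [] (mulT g (pull B X f))))
        = fun f => G * (toBCF (wordD [] f)).compContinuous ⟨_, hφ⟩ := rfl
    rw [h]
    exact continuous_const.mul
      ((BoundedContinuousFunction.continuous_compContinuous _).comp (continuous_wordD []))
  | cons d w ih =>
    cases d with
    | none =>
      have h : (fun f => toBCF (wordD (none :: w) (mulT g (pull B X f)))) = fun f =>
          toBCF (wordD w (mulT (derivT g) (pull B X f)))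
            + (toBCF (wordD w (mulT g (pull B X (dt f))))
              + toBCF (wordD w (mulT (mulCT g (derivRT B)) (pull B X (dX X f))))) := by
        funext f
        rw [← map_add, ← map_add, ← map_add, ← map_add, ← mulT_mulT, ← map_add, ← dt_pull,
          ← dt_mulT]
        rfl
      rw [h]
      exact (ih _).add (((ih _).comp continuous_dt).add ((ih _).comp (continuous_dX X)))
    | some i =>
      have h : (fun f => toBCF (wordD (some i :: w) (mulT g (pull B X f)))) = fun f =>
          ∑ j, toBCF (wordD w (mulT (mulCT g (adCoeff B X (basisH i) (imCoord j)))
            (pull B X (frame (some j) f)))) := by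
        funext f
        simp only [← mulT_mulT]
        rw [← map_sum, ← map_sum, ← map_sum, ← dX_pull, ← dX_mulT]
        rfl
      rw [h]
      exact continuous_finsetSum _ fun j _ => (ih _).comp (continuous_frame (some j))

lemma continuous_pull (B : RT) (X : imH) : Continuous (pull B X) := by
  let one : CT := ⟨fun _ => 1, fun _ => rfl, contDiff_const⟩
  have h : ∀ f, mulT one f = f := fun f => by
    ext p
    exact one_mul _
  refine (continuous_iff_wordD _).2 fun w => ?_
  simpa only [h] using continuous_toBCF_wordD_mulT_pull B X w one

/-- `pull` as a continuous linear map. -/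
def pullL (B : RT) (X : imH) : CTS →L[ℂ] CTS := ⟨pull B X, continuous_pull B X⟩

/-! ### The series of `Ψ_a` as a translated Fourier series -/

lemma rep_mul_star_self (U : Frames) (k : ℕ) (x : S3) : rep U k x * star (rep U k x) = 1 :=
  mul_eq_one_comm.1 (star_rep_mul_self U k x)

/-- A symbol that does not depend on the point determines the matrices along the flow. -/
lemma rep_mul_expS3 {U : Frames} {X : imH}
    (hX : ∀ (k : ℕ) (x : S3),
      symbol U X k x = Matrix.diagonal fun m => Complex.I * (weight k m : ℂ))
    (k : ℕ) (x : S3) (i j : Fin (k + 1)) (s : ℝ) :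
    rep U k (x * expS3 (s • X)) i j
      = Complex.exp (Complex.I * weight k j * s) * rep U k x i j := by
  set c : ℂ := Complex.I * weight k j with hc
  let one : CT := ⟨fun _ => 1, fun _ => rfl, contDiff_const⟩
  let f : CTS := tensor (repS U k i j) one
  have hf : ∀ t x, f (t, x) = rep U k x i j := fun t x => one_mul _
  have hd : ∀ z, dX X f (0, z) = c * rep U k z i j := by
    intro z
    have h1 : (Matrix.of fun i j => deriv (fun s : ℝ => rep U k (z * expS3 (s • X)) i j) 0)
        = rep U k z * Matrix.diagonal fun m => Complex.I * (weight k m : ℂ) := by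
      rw [← hX k z, symbol, ← mul_assoc, rep_mul_star_self, one_mul]
    have h2 := congrFun (congrFun h1 i) j
    rw [Matrix.mul_diagonal, Matrix.of_apply] at h2
    rw [dX_apply]
    simp only [hf]
    rw [h2, mul_comm]
  have hder : ∀ s : ℝ, HasDerivAt
      (fun s : ℝ => Complex.exp (-(c * s)) * rep U k (x * expS3 (s • X)) i j) 0 s := by
    intro s
    have h1 := hasDerivAt_flow f X 0 x s
    simp only [hf, hd] at h1
    have h2 : HasDerivAt (fun s : ℝ => -(c * (s : ℂ))) (-(c * 1)) s :=
      ((Complex.ofRealCLM.hasDerivAt (x := s)).const_mul c).neg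
    refine (h2.cexp.fun_mul h1).congr_deriv ?_
    ring
  have hconst := is_const_of_deriv_eq_zero (fun s => (hder s).differentiableAt)
    (fun s => (hder s).deriv) s 0
  simp only [Complex.ofReal_zero, mul_zero, neg_zero, Complex.exp_zero, one_mul, zero_smul,
    expS3_zero, mul_one] at hconst
  rw [← hconst, ← mul_assoc, ← Complex.exp_add, add_neg_cancel, Complex.exp_zero, one_mul]

/-- The function `A` on `𝕋¹`. -/
def primRT (a : RT) : RT := ⟨primA a, periodic_primA a, contDiff_primA a⟩

lemma deriv_primRT (a : RT) (t : ℝ) : deriv (primRT a).1 t = a.1 t - mean a := by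
  have hc : Continuous a.1 := a.2.2.continuous
  have h := (hc.integral_hasStrictDerivAt 0 t).hasDerivAt.sub
    ((hasDerivAt_id t).const_mul (mean a))
  rw [mul_one] at h
  exact h.deriv

lemma neg_primRT_apply (a : RT) (t : ℝ) : (-primRT a).1 t = -primA a t := rfl

lemma deriv_neg_primRT (a : RT) (t : ℝ) : deriv (-primRT a).1 t = mean a - a.1 t := by
  have h : deriv (-primRT a).1 t = -deriv (primRT a).1 t := deriv.neg
  rw [h, deriv_primRT, neg_sub]

/-- `Ψ_a` acts on isotypic components, hence on smooth functions, as a translation in `S³`. -/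
lemma psiTerm_eq {U : Frames} {X : imH}
    (hX : ∀ (k : ℕ) (x : S3),
      symbol U X k x = Matrix.diagonal fun m => Complex.I * (weight k m : ℂ))
    (a : RT) (u : CTS) (t : ℝ) (x : S3) (k : ℕ) :
    psiTerm a U u (t, x) k = isoProj U k u (t, x * expS3 (primA a t • X)) := by
  rw [isoProj_apply_eq_sum, psiTerm]
  simp only [rep_mul_expS3 hX, expA]
  congr 1
  refine Finset.sum_congr rfl fun m _ => Finset.sum_congr rfl fun n _ => ?_
  ring

/-- On distributions `Ψ_a` is the transpose of the inverse translation. -/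
lemma psiTermD_eq {U : Frames} {X : imH}
    (hX : ∀ (k : ℕ) (x : S3),
      symbol U X k x = Matrix.diagonal fun m => Complex.I * (weight k m : ℂ))
    (a : RT) (u : Distr) (φ : CTS) (k : ℕ) :
    psiTermD a U u φ k = u (pull (-primRT a) X (isoProj U k φ)) := by
  have h : pull (-primRT a) X (isoProj U k φ) = ((k : ℂ) + 1) •
      ∑ m : Fin (k + 1), ∑ n : Fin (k + 1), tensor (repConjS U k n m)
        (mulCT (expA a (weight k m)) (fiberInt φ (repS U k n m))) := by
    ext ⟨t, y⟩
    rw [pull_apply, neg_primRT_apply, isoProj_apply,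
      ← sum_integral_mul_mul (g := fun m n => repS U k n m)
        (c := fun m n => star (rep U k (y * expS3 (-primA a t • X)) n m)) φ t
        fun x => sum_rep_mul_star_rep_eq_zonalS U k _ x,
      CTS.smul_apply, CTS.sum_apply]
    simp only [CTS.sum_apply]
    congr 1
    refine Finset.sum_congr rfl fun m _ => Finset.sum_congr rfl fun n _ => ?_
    have he : star (rep U k (y * expS3 (-primA a t • X)) n m)
        = Complex.exp (Complex.I * weight k m * primA a t) * star (rep U k y n m) := by
      rw [rep_mul_expS3 hX, star_mul', Complex.star_def, ← Complex.exp_conj]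
      congr 2
      simp
    rw [he]
    change (∫ x, φ (t, x) * rep U k x n m ∂haarS3) * _
      = Complex.exp (Complex.I * weight k m * primA a t) * (∫ x, φ (t, x) * rep U k x n m ∂haarS3)
        * star (rep U k y n m)
    ring
  rw [h, map_smul, map_sum, psiTermD, smul_eq_mul]
  simp only [map_sum]
  rfl

lemma opLD_apply (a : RT) (X : imH) (u : Distr) (φ : CTS) :
    opLD a X u φ = -u (opL a X φ) := by
  rw [opL, ← dX_mulT, map_add, neg_add]
  rfl

end TorusSphere

end

/-- For `a ∈ C^∞(𝕋¹)` real-valued, for a left-invariant vector field `X` on `S³` and for matrix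
representatives `t^ℓ` of the unitary dual of `S³` in which `X` has the symbol
`σ_X(ℓ)_{mn} = i m δ_{mn}` (which forces the normalization `|X| = 1/2`, and can be arranged for
every such `X` by a unitary change of basis), the series that define `Ψ_a` converge and define an automorphism `Ψ_a` of
`C^∞(𝕋¹ × S³)` and one of `𝓓'(𝕋¹ × S³)`, and `Ψ_a ∘ L = L_{a₀} ∘ Ψ_a` on both spaces. -/
theorem proposition4p5 (a : RT) (X : imH) (U : Frames)
    (hX : ∀ (k : ℕ) (x : S3),
      symbol U X k x = Matrix.diagonal fun m => Complex.I * (weight k m : ℂ)) :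
    (∃ Ψ : CTS ≃ₗ[ℂ] CTS,
      (∀ (u : CTS) (p : ℝ × S3), HasSum (psiTerm a U u p) (Ψ u p)) ∧
      ∀ u : CTS, Ψ (opL a X u) = opL (RT.const (mean a)) X (Ψ u)) ∧
    (∃ Ψ : Distr ≃ₗ[ℂ] Distr,
      (∀ (u : Distr) (φ : CTS), HasSum (psiTermD a U u φ) (Ψ u φ)) ∧
      ∀ u : Distr, Ψ (opLD a X u) = opLD (RT.const (mean a)) X (Ψ u)) := by
  have hadd : ∀ t, (primRT a).1 t + (-primRT a).1 t = 0 := fun t => add_neg_cancel _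
  have hadd' : ∀ t, (-primRT a).1 t + (primRT a).1 t = 0 := fun t => neg_add_cancel _
  have hd : ∀ t, deriv (primRT a).1 t + (RT.const (mean a)).1 t = a.1 t := fun t => by
    rw [deriv_primRT]
    exact sub_add_cancel _ _
  have hd' : ∀ t, deriv (-primRT a).1 t + a.1 t = (RT.const (mean a)).1 t := fun t => by
    rw [deriv_neg_primRT]
    exact sub_add_cancel _ _
  constructor
  · refine ⟨LinearEquiv.ofLinearMap (pull (primRT a) X) (pull (-primRT a) X)
      (LinearMap.ext fun f => pull_pull_of_add_eq_zero hadd X f)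
      (LinearMap.ext fun f => pull_pull_of_add_eq_zero hadd' X f), ?_, ?_⟩
    · rintro u ⟨t, x⟩
      simp only [funext (psiTerm_eq hX a u t x)]
      exact hasSum_isoProj_apply U u (t, x * expS3 (primA a t • X))
    · intro u
      exact (opL_pull hd X u).symm
  · refine ⟨{ toFun := fun u => u.comp (pullL (-primRT a) X)
              invFun := fun u => u.comp (pullL (primRT a) X)
              map_add' := fun _ _ => rfl
              map_smul' := fun _ _ => rfl
              left_inv := fun u => ContinuousLinearMap.ext fun f =>
                congrArg u (pull_pull_of_add_eq_zero hadd' X f)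
              right_inv := fun u => ContinuousLinearMap.ext fun f =>
                congrArg u (pull_pull_of_add_eq_zero hadd X f) }, ?_, ?_⟩
    · intro u φ
      simp only [funext (psiTermD_eq hX a u φ)]
      exact (hasSum_isoProj U φ).mapL (u.comp (pullL (-primRT a) X))
    · intro u
      ext φ
      change opLD a X u (pull (-primRT a) X φ)
        = opLD (RT.const (mean a)) X (u.comp (pullL (-primRT a) X)) φ
      rw [opLD_apply, opLD_apply, opL_pull hd']
      rfl
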